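/- Let $K=\mathbb F_q$ be a finite field of characteristic $p$ and let $\mathfrak g$ be a Lie subalgebra of the Lie algebra $\mathfrak{ut}(N,K)$ of upper triangular $N\times N$ matrices with zeros on the diagonal. Suppose that $p$ is so large that every product of $p$ matrices from $\mathfrak g$ vanishes (this holds, for instance, when $p\ge N$), and put $\exp(x)=\sum_{k<p}x^k/k!$ for $x\in\mathfrak g$. Let $\mathfrak h\subseteq\mathfrak g$ be a Lie subalgebra. Then $\exp$ is a bijection of $\mathfrak g$ onto a subgroup $G=\exp(\mathfrak g)$ of $\mathrm{GL}_N(K)$, and of $\mathfrak h$ onto a subgroup $H=\exp(\mathfrak h)$. The group $G$ acts on the dual space $\mathfrak g^*$ by the coadjoint representation $(\mathrm{Ad}^*_u\lambda)(x)=\lambda(u^{-1}xu)$; likewise $H$ acts on $\mathfrak h^*$. Fix a non-trivial additive character $\psi:K\to\mathbb C^*$. A polarization of $\lambda\in\mathfrak g^*$ is a subalgebra $\mathfrak p$ of $\mathfrak g$ that is a maximal isotropic subspace for the bilinear form $(x,y)\mapsto\lambda([x,y])$. For a coadjoint orbit $\Omega\subseteq\mathfrak g^*$ let $T^\Omega$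 be the complex representation $\mathrm{ind}(\xi_\lambda,\exp(\mathfrak p),G)$, where $\lambda\in\Omega$, $\mathfrak p$ is a polarization of $\lambda$, and $\xi_\lambda$ is the one-dimensional representation $\xi_\lambda(\exp x)=\psi(\lambda(x))$ of $\exp(\mathfrak p)$; define $t^\omega$ in the same way for $H$ and a coadjoint orbit $\omega\subseteq\mathfrak h^*$. Such representations $T^\Omega$ and $t^\omega$ exist for all coadjoint orbits $\Omega\subseteq\mathfrak g^*$ and $\omega\subseteq\mathfrak h^*$. Let $\pi:\mathfrak g^*\to\mathfrak h^*$ be the restriction map. Then, for all coadjoint orbits $\Omega\subseteq\mathfrak g^*$ and $\omega\subseteq\mathfrak h^*$, and for every choice of $\lambda$ and $\mathfrak p$ in the construction of $T^\Omega$ and of $t^\omega$, the representations $T^\Omega$ and $t^\omega$ are irreducible, the multiplicity of $T^\Omega$ in $\mathrm{ind}(t^\omega,G)$ equals the multiplicity of $t^\omega$ in $\mathrm{res}(T^\Omega,H)$, and $$\mathrm{mult}\bigl(T^\Omega,\mathrm{ind}(t^\omega,G)\bigr)=\mathrm{mult}\bigl(t^\omega,\mathrm{res}(T^\Omega,H)\bigr)=\frac{|\pi^{-1}(\omega)\cap\Omega|}{\sqrt{|\omega|\cdot|\Omega|}}.$$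 -/

import Mathlib

universe u v w

attribute [local instance 100] LieRing.ofAssociativeRing

noncomputable section

namespace UnipotentOrbit

open Matrix

variable {K : Type*} [Field K] {N : ℕ}

/-- The Lie algebra of all upper triangular `N × N` matrices with zeros on the diagonal. -/
def ut (N : ℕ) (K : Type*) [Field K] : LieSubalgebra K (Matrix (Fin N) (Fin N) K) where
  carrier := {x | ∀ i j, j ≤ i → x i j = 0}
  zero_mem' := fun _ _ _ => rfl
  add_mem' := fun {x y} hx hy i j hij => by simp [hx i j hij, hy i j hij]
  smul_mem' := fun c x hx i j hij => by simp [hx i j hij]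
  lie_mem' := by
    have key : ∀ x y : Matrix (Fin N) (Fin N) K, (∀ i j, j ≤ i → x i j = 0) →
        (∀ i j, j ≤ i → y i j = 0) → ∀ i j, j ≤ i → (x * y) i j = 0 := by
      intro x y hx hy i j hij
      rw [Matrix.mul_apply]
      refine Finset.sum_eq_zero fun k _ => ?_
      rcases le_total k i with h | h
      · rw [hx i k h, zero_mul]
      · rw [hy k j (hij.trans h), mul_zero]
    intro x y hx hy i j hij
    simp [Ring.lie_def, key x y hx hy i j hij, key y x hy hx i j hij]

/-- The exponential `∑_{k < p} x ^ k / k!` of a matrix `x` with `x ^ p = 0` over a field of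
characteristic `p`. -/
def matExp (p : ℕ) (x : Matrix (Fin N) (Fin N) K) : Matrix (Fin N) (Fin N) K :=
  ∑ k ∈ Finset.range p, ((k.factorial : K)⁻¹) • x ^ k

/-- The group `exp 𝔤`: the subgroup of `GL_N(K)` generated by the exponentials of the elements
of `𝔤`. When `p` is large enough for `𝔤`, its elements are exactly these exponentials; this is part
of the conclusion of the main theorem. -/
def expGroup (p : ℕ) (g : LieSubalgebra K (Matrix (Fin N) (Fin N) K)) :
    Subgroup (GL (Fin N) K) :=
  Subgroup.closure {u | ∃ x ∈ g, (u : Matrix (Fin N) (Fin N) K) = matExp p x}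

theorem expGroup_mono (p : ℕ) {h g : LieSubalgebra K (Matrix (Fin N) (Fin N) K)} (hle : h ≤ g) :
    expGroup p h ≤ expGroup p g :=
  Subgroup.closure_mono fun _ ⟨x, hx, hu⟩ => ⟨x, hle hx, hu⟩

/-- The coadjoint orbit of `l ∈ 𝔤*` under `G = exp 𝔤`: the forms `x ↦ l (u⁻¹ x u)` with `u ∈ G`. -/
def coadjointOrbit (p : ℕ) (g : LieSubalgebra K (Matrix (Fin N) (Fin N) K))
    (l : Module.Dual K g) : Set (Module.Dual K g) :=
  {m | ∃ u ∈ expGroup p g, ∀ x : g, ∃ y : g,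
    (y : Matrix (Fin N) (Fin N) K) =
        ((u⁻¹ : GL (Fin N) K) : Matrix (Fin N) (Fin N) K) * x * (u : Matrix (Fin N) (Fin N) K) ∧
      m x = l y}

/-- `Ω` is a coadjoint orbit in `𝔤*`. -/
def IsCoadjointOrbit (p : ℕ) (g : LieSubalgebra K (Matrix (Fin N) (Fin N) K))
    (Ω : Set (Module.Dual K g)) : Prop :=
  ∃ l : Module.Dual K g, Ω = coadjointOrbit p g l

/-- The natural projection `𝔤* → 𝔥*` for a subalgebra `𝔥` of `𝔤`. -/
def restrict {h g : LieSubalgebra K (Matrix (Fin N) (Fin N) K)} (hle : h ≤ g)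
    (l : Module.Dual K g) : Module.Dual K h :=
  l.comp (LieSubalgebra.inclusion hle : h →ₗ[K] g)

/-- A subspace of a Lie algebra is isotropic for `l` if `l ([x, y]) = 0` on it. -/
def IsIsotropic {L : Type*} [LieRing L] [LieAlgebra K L] (l : Module.Dual K L)
    (W : Submodule K L) : Prop :=
  ∀ x ∈ W, ∀ y ∈ W, l ⁅x, y⁆ = 0

/-- A subalgebra is a polarization of `l` if it is a maximal isotropic subspace for the form
`l ([x, y])`. -/
def IsPolarization {L : Type*} [LieRing L] [LieAlgebra K L] (l : Module.Dual K L)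
    (q : LieSubalgebra K L) : Prop :=
  Maximal (IsIsotropic l) q.toSubmodule

theorem map_incl_le {g : LieSubalgebra K (Matrix (Fin N) (Fin N) K)} (q : LieSubalgebra K g) :
    q.map g.incl ≤ g := by
  rintro _ ⟨x, _, rfl⟩
  exact x.2

/-- The subgroup `P = exp 𝔮` of `G = exp 𝔤` for a subalgebra `𝔮` of `𝔤`, as a subgroup of
`GL_N(K)`. -/
def subExpGroup (p : ℕ) {g : LieSubalgebra K (Matrix (Fin N) (Fin N) K)}
    (q : LieSubalgebra K g) : Subgroup (GL (Fin N) K) :=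
  expGroup p (q.map g.incl)

/-- The inclusion of `P = exp 𝔮` into `G = exp 𝔤`. -/
def subExpGroupIncl (p : ℕ) {g : LieSubalgebra K (Matrix (Fin N) (Fin N) K)}
    (q : LieSubalgebra K g) : subExpGroup p q →* expGroup p g :=
  Subgroup.inclusion (expGroup_mono p (map_incl_le q))

/-- `T` belongs to the class `T^Ω` of representations of `G = exp 𝔤`: for some `l ∈ Ω` and some
polarization `𝔮` of `l`, it is equivalent to the representation induced from `P = exp 𝔮` by the
one-dimensional representation `ξ` with `ξ (exp x) = ψ (l x)`. -/
def IsOrbitRep (p : ℕ) (ψ : AddChar K ℂ) {g : LieSubalgebra K (Matrix (Fin N) (Fin N) K)}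
    (Ω : Set (Module.Dual K g)) {V : Type*} [AddCommGroup V] [Module ℂ V]
    (T : Representation ℂ (expGroup p g) V) : Prop :=
  ∃ l ∈ Ω, ∃ q : LieSubalgebra K g, IsPolarization l q ∧
    ∃ ξ : Representation ℂ (subExpGroup p q) ℂ,
      (∀ (u : subExpGroup p q) (x : g), x ∈ q →
        ((u : GL (Fin N) K) : Matrix (Fin N) (Fin N) K) = matExp p (x : Matrix (Fin N) (Fin N) K) →
          ∀ z : ℂ, ξ u z = ψ (l x) * z) ∧
      Nonempty (T.Equiv (Representation.ind (subExpGroupIncl p q) ξ))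

/-- The multiplicity of an irreducible representation `T` in a finite-dimensional complex
representation `R` of a finite group: the largest `m` such that the direct sum of `m` copies of `T`
embeds in `R`. -/
def mult {G V W : Type*} [Group G] [AddCommGroup V] [Module ℂ V] [AddCommGroup W] [Module ℂ W]
    (T : Representation ℂ G V) (R : Representation ℂ G W) : ℕ :=
  sSup {m : ℕ | ∃ f : (T.finsupp (Fin m)).IntertwiningMap R, Function.Injective f}

/-- The inclusion of `H = exp 𝔥` into `G = exp 𝔤`, for `𝔥 ⊆ 𝔤`. -/
def expIncl (p : ℕ) {h g : LieSubalgebra K (Matrix (Fin N) (Fin N) K)} (hle : h ≤ g) :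
    expGroup p h →* expGroup p g :=
  Subgroup.inclusion (expGroup_mono p hle)

end UnipotentOrbit

end

/-! Three facts carry the theorem.

The set `exp W` is a group when `W` is a Lie algebra of matrices with `W ^ p = 0`. Instead of the
Campbell–Hausdorff series, the proof uses a differential equation. For an ideal `V` of `W`, the
polynomial `exp (-tx) exp (t(x + y))` with `y ∈ V` has logarithmic derivative in `V`, and such
polynomials factor into exponentials of elements of `V`, one power of `t` at a time
(`evalOne_mem_of_euler_eq`). Induction along a chain of ideals of codimension one then gives
`expClosed`; the same argument shows that `exp x ↦ ψ (l x)` is multiplicative where `l` kills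
brackets.

Polarizations exist by Vergne's construction: the radicals of `l` on the members of a flag of ideals
add up to one (`exists_isotropic_of_ideal`). A polarization `q` is its own orthogonal, so `|q|² =
|g| |rad l|`; since the stabilizer of `l` is `exp (rad l)`, this yields `|Ω| = d²` with `d = |q^⊥|`,
where `q^⊥` is the annihilator of `q` in `g*`. It also shows that `l + q^⊥` is a single `exp
q`-orbit.

Averaging over that orbit turns the induced character into Kirillov's formula `d χ(exp x) = ∑_{m ∈
Ω} ψ (m x)`. Orthogonality of additive characters then makes intertwining numbers into counts of
coincidences between linear forms (`finrank_intertwiningMap_eq_card`): `Ω` against itself gives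
irreducibility, and `Ω` restricted to `h` against `ω` gives the multiplicity. Frobenius reciprocity
gives the equality of the two multiplicities. -/

noncomputable section
namespace UnipotentOrbit

/-! ### Truncated exponentials -/

section TruncExp

variable {K : Type*} [Field K] {A : Type*} [Ring A] [Algebra K A]

variable (K) in
/-- The exponential series truncated at degree `p`. -/
def truncExp (p : ℕ) (x : A) : A :=
  ∑ k ∈ Finset.range p, ((k.factorial : K)⁻¹) • x ^ k

variable (p : ℕ)

@[simp]
theorem truncExp_zero [Fact p.Prime] : truncExp K p (0 : A) = 1 := by
  rw [truncExp, Finset.sum_eq_single 0]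
  · simp
  · intro k _ hk
    simp [hk]
  · intro h
    exact absurd (Finset.mem_range.2 (Fact.out : p.Prime).pos) h

theorem commute_truncExp {a b : A} (h : Commute a b) : Commute a (truncExp K p b) :=
  Commute.sum_right _ _ _ fun _ _ => (h.pow_right _).smul_right _

theorem ad_pow_apply_eq_sum (a w : A) (n : ℕ) :
    ((LieAlgebra.ad K A a) ^ n) w =
      ∑ m ∈ Finset.HasAntidiagonal.antidiagonal n, n.choose m.1 • (a ^ m.1 * w * (-a) ^ m.2) := by
  have h1 : LieAlgebra.ad K A a = LinearMap.mulLeft K a + LinearMap.mulRight K (-a) := by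
    ext w
    simp [Ring.lie_def, sub_eq_add_neg]
  have h2 : Commute (LinearMap.mulLeft K a) (LinearMap.mulRight K (-a)) :=
    LinearMap.commute_mulLeft_right _ _
  rw [h1, h2.add_pow', LinearMap.sum_apply]
  refine Finset.sum_congr rfl fun m _ => ?_
  rw [LinearMap.smul_apply, LinearMap.pow_mulLeft, LinearMap.pow_mulRight, Module.End.mul_apply,
    LinearMap.mulLeft_apply, LinearMap.mulRight_apply, mul_assoc]

variable [CharP K p] [Fact p.Prime]

variable (K) in
theorem factorial_ne_zero_of_lt {k : ℕ} (hk : k < p) : (k.factorial : K) ≠ 0 := by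
  rw [Ne, CharP.cast_eq_zero_iff K p, (Fact.out : p.Prime).dvd_factorial]
  omega

/-- Terms with `i + j ≥ p` vanish and all factorials below `p` are invertible, so the Cauchy product
regroups as for full series. This serves both `exp a exp b = exp (a + b)` and `Ad (exp a) = exp (ad
a)`. -/
theorem sum_sum_factorial_inv_smul {V : Type*} [AddCommGroup V] [Module K V] (f : ℕ → ℕ → V)
    (hf : ∀ i j, p ≤ i + j → f i j = 0) :
    ∑ i ∈ Finset.range p, ∑ j ∈ Finset.range p,
        ((i.factorial : K)⁻¹ * (j.factorial : K)⁻¹) • f i j =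
      ∑ n ∈ Finset.range p, (n.factorial : K)⁻¹ •
        ∑ m ∈ Finset.HasAntidiagonal.antidiagonal n, n.choose m.1 • f m.1 m.2 := by
  have h1 : ∀ i ∈ Finset.range p, ∑ j ∈ Finset.range p,
      ((i.factorial : K)⁻¹ * (j.factorial : K)⁻¹) • f i j =
      ∑ j ∈ Finset.range (p - i), ((i.factorial : K)⁻¹ * (j.factorial : K)⁻¹) • f i j := by
    intro i _
    symm
    apply Finset.sum_subset (Finset.range_mono (Nat.sub_le _ _))
    intro j _ hj
    rw [hf i j (by simp at hj; omega), smul_zero]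
  rw [Finset.sum_congr rfl h1, ← Finset.sum_range_diag_flip p
    (fun i j => ((i.factorial : K)⁻¹ * (j.factorial : K)⁻¹) • f i j)]
  refine Finset.sum_congr rfl fun n hn => ?_
  rw [Finset.Nat.sum_antidiagonal_eq_sum_range_succ (fun i j => n.choose i • f i j),
    Finset.smul_sum]
  refine Finset.sum_congr rfl fun i hi => ?_
  have hi' : i ≤ n := by simp at hi; omega
  have hn' : n < p := by simpa using hn
  rw [← Nat.cast_smul_eq_nsmul K, smul_smul, ← Nat.choose_mul_factorial_mul_factorial hi']
  congr 1
  have a1 := factorial_ne_zero_of_lt K p (lt_of_le_of_lt hi' hn')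
  have a2 := factorial_ne_zero_of_lt K p (lt_of_le_of_lt (Nat.sub_le n i) hn')
  have a3 : (n.choose i : K) ≠ 0 := by
    have := factorial_ne_zero_of_lt K p hn'
    rw [← Nat.choose_mul_factorial_mul_factorial hi'] at this
    push_cast at this
    exact fun h => this (by simp [h])
  push_cast
  field_simp

theorem truncExp_mul_truncExp {a b : A} (hab : Commute a b)
    (h : ∀ i j, p ≤ i + j → a ^ i * b ^ j = 0) :
    truncExp K p a * truncExp K p b = truncExp K p (a + b) := by
  have := sum_sum_factorial_inv_smul (K := K) p (fun i j => a ^ i * b ^ j) h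
  simp only [truncExp, Finset.sum_mul_sum, smul_mul_smul_comm]
  rw [this]
  refine Finset.sum_congr rfl fun n _ => ?_
  rw [hab.add_pow']

theorem truncExp_mul_truncExp_neg {a : A} (h : a ^ p = 0) :
    truncExp K p a * truncExp K p (-a) = 1 := by
  rw [truncExp_mul_truncExp p (Commute.neg_right (Commute.refl a)), add_neg_cancel,
    truncExp_zero]
  intro i j hij
  rw [neg_pow, ← mul_assoc, (Commute.neg_one_right (a ^ i)).pow_right j |>.eq, mul_assoc, ← pow_add,
    pow_eq_zero_of_le hij h, mul_zero]

theorem truncExp_neg_mul_truncExp {a : A} (h : a ^ p = 0) :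
    truncExp K p (-a) * truncExp K p a = 1 := by
  have := truncExp_mul_truncExp_neg (K := K) p (a := -a) (by rw [neg_pow, h, mul_zero])
  rwa [neg_neg] at this

theorem truncExp_mul_mul_truncExp_neg {a w : A} (h : ∀ i j, p ≤ i + j → a ^ i * w * a ^ j = 0) :
    truncExp K p a * w * truncExp K p (-a) =
      ∑ k ∈ Finset.range p, (k.factorial : K)⁻¹ • ((LieAlgebra.ad K A a) ^ k) w := by
  have h' : ∀ i j, p ≤ i + j → a ^ i * w * (-a) ^ j = 0 := by
    intro i j hij
    rw [neg_pow, ← (Commute.neg_one_right (a ^ j)).pow_right j |>.eq, ← mul_assoc, h i j hij,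
      zero_mul]
  have := sum_sum_factorial_inv_smul (K := K) p (fun i j => a ^ i * w * (-a) ^ j) h'
  simp only [truncExp, Finset.sum_mul, Finset.mul_sum, smul_mul_assoc, mul_smul_comm,
    ad_pow_apply_eq_sum]
  rw [← this, Finset.sum_comm]
  simp only [Finset.smul_sum, smul_smul, mul_comm]

/-- If the truncated exponential of a nilpotent endomorphism fixes a vector, then the endomorphism
kills it. -/
theorem apply_eq_zero_of_sum_pow_apply_eq {V : Type*} [AddCommGroup V] [Module K V]
    (D : Module.End K V) (v : V) (m : ℕ) (hm : (D ^ m) v = 0)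
    (h : ∑ k ∈ Finset.range p, (k.factorial : K)⁻¹ • (D ^ k) v = v) : D v = 0 := by
  induction m with
  | zero => simp at hm; simp [hm]
  | succ m ih =>
    rcases m with _ | m
    · simpa using hm
    · apply ih
      have hp2 := (Fact.out : p.Prime).two_le
      obtain ⟨q, rfl⟩ : ∃ q, p = q + 2 := ⟨p - 2, by omega⟩
      rw [Finset.sum_range_succ', Finset.sum_range_succ'] at h
      -- Since `D ^ (m + 2)` kills `v`, only the terms `k = 0, 1` survive `D ^ m`. The first cancels
      -- against the right side, leaving `D ^ (m + 1) v = 0`.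
      have h1 := congrArg (D ^ m) h
      simp only [map_add, map_sum, map_smul, ← Module.End.mul_apply, ← pow_add] at h1
      rw [Finset.sum_eq_zero] at h1
      · simpa using h1
      · intro k _
        have : m + (k + 1 + 1) = k + (m + 1 + 1) := by ring
        rw [this, pow_add, Module.End.mul_apply, hm, map_zero, smul_zero]

end TruncExp

/-! ### Graded polynomials and the differential equation of the exponential -/

section GradedPolynomials

open Polynomial

variable {K : Type*} [Field K] {A : Type*} [Ring A] [Algebra K A]

/-- The polynomials whose coefficient in degree `i` lies in `M ^ i`. -/
def gradedPoly (M : Submodule K A) : Subalgebra K A[X] where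
  carrier := {F | ∀ i, F.coeff i ∈ M ^ i}
  mul_mem' := by
    intro F G hF hG k
    rw [coeff_mul]
    refine Submodule.sum_mem _ fun m hm => ?_
    rw [← Finset.HasAntidiagonal.mem_antidiagonal.1 hm, pow_add]
    exact Submodule.mul_mem_mul (hF _) (hG _)
  add_mem' := by
    intro F G hF hG k
    rw [coeff_add]
    exact Submodule.add_mem _ (hF k) (hG k)
  algebraMap_mem' := by
    intro r k
    rw [Polynomial.algebraMap_apply, coeff_C]
    split_ifs with h
    · subst h
      rw [pow_zero]
      exact Submodule.algebraMap_mem r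
    · exact Submodule.zero_mem _

theorem coeff_mul_eq_zero_of_lt {F G : A[X]} {m n : ℕ} (hF : ∀ i < m, F.coeff i = 0)
    (hG : ∀ i < n, G.coeff i = 0) : ∀ i < m + n, (F * G).coeff i = 0 := by
  intro k hk
  rw [coeff_mul]
  refine Finset.sum_eq_zero fun a ha => ?_
  have := Finset.HasAntidiagonal.mem_antidiagonal.1 ha
  by_cases h : a.1 < m
  · rw [hF _ h, zero_mul]
  · rw [hG _ (by omega), mul_zero]

theorem coeff_pow_eq_zero_of_lt {F : A[X]} (hF : F.coeff 0 = 0) (n : ℕ) :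
    ∀ i < n, (F ^ n).coeff i = 0 := by
  induction n with
  | zero => simp
  | succ n ih =>
    rw [pow_succ]
    exact coeff_mul_eq_zero_of_lt ih (n := 1) (by intro i hi; rwa [Nat.lt_one_iff.1 hi])

/-- Coefficients in degree `p` and above lie in `M ^ p = 0`. Thus only degrees below `p`, which are
invertible in `K` when positive, ever matter. -/
theorem eq_zero_of_mem_gradedPoly {M : Submodule K A} {p : ℕ} (hM : M ^ p = ⊥) {F : A[X]}
    (hF : F ∈ gradedPoly M) (h : ∀ i < p, F.coeff i = 0) : F = 0 := by
  ext i
  by_cases hi : i < p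
  · simpa using h i hi
  · have := hF i
    rw [← Nat.add_sub_cancel' (not_lt.1 hi), pow_add, hM, Submodule.bot_mul] at this
    simpa [Nat.add_sub_cancel' (not_lt.1 hi)] using this

theorem pow_mul_mul_pow_eq_zero {M : Submodule K A} {p : ℕ} (hM : M ^ p = ⊥) {a w : A[X]}
    (ha : a ∈ gradedPoly M) (ha0 : a.coeff 0 = 0) (hw : w ∈ gradedPoly M) (i j : ℕ)
    (hij : p ≤ i + j) : a ^ i * w * a ^ j = 0 := by
  refine eq_zero_of_mem_gradedPoly hM (mul_mem (mul_mem (pow_mem ha _) hw) (pow_mem ha _)) ?_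
  intro k hk
  refine coeff_mul_eq_zero_of_lt (coeff_mul_eq_zero_of_lt (coeff_pow_eq_zero_of_lt ha0 i)
    (n := 0) (by simp)) (coeff_pow_eq_zero_of_lt ha0 j) k (by omega)

theorem pow_eq_zero_of_mem_gradedPoly {M : Submodule K A} {p : ℕ} (hM : M ^ p = ⊥) {a : A[X]}
    (ha : a ∈ gradedPoly M) (ha0 : a.coeff 0 = 0) : a ^ p = 0 := by
  simpa using pow_mul_mul_pow_eq_zero hM ha ha0 (one_mem _) p 0 le_rfl

theorem truncExp_mem_gradedPoly {M : Submodule K A} (p : ℕ) {a : A[X]} (ha : a ∈ gradedPoly M) :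
    truncExp K p a ∈ gradedPoly M :=
  sum_mem fun _ _ => Subalgebra.smul_mem _ (pow_mem ha _) _

theorem truncExp_coeff_zero (p : ℕ) [hp : Fact p.Prime] {a : A[X]} (ha0 : a.coeff 0 = 0) :
    (truncExp K p a).coeff 0 = 1 := by
  rw [truncExp, finsetSum_coeff, Finset.sum_eq_single 0]
  · simp
  · intro k _ hk
    rw [coeff_smul, coeff_pow_eq_zero_of_lt ha0 k 0 (Nat.pos_of_ne_zero hk), smul_zero]
  · intro h
    exact absurd (Finset.mem_range.2 hp.out.pos) h

/-- The Euler derivation `X d/dX`. -/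
def euler (F : A[X]) : A[X] := X * derivative F

theorem euler_mul (F G : A[X]) : euler (F * G) = euler F * G + F * euler G := by
  simp only [euler, derivative_mul, mul_add]
  rw [← mul_assoc, ← mul_assoc, ← mul_assoc, (X_mul : X * F = F * X)]

theorem coeff_euler (F : A[X]) (i : ℕ) : (euler F).coeff i = (i : A) * F.coeff i := by
  rw [euler]
  rcases i with _ | i
  · simp
  · rw [coeff_X_mul, coeff_derivative, ← Nat.cast_succ, (Nat.cast_commute _ _).eq]

theorem euler_smul (c : K) (F : A[X]) : euler (c • F) = c • euler F := by
  simp [euler]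

theorem euler_sum {ι : Type*} (s : Finset ι) (F : ι → A[X]) :
    euler (∑ i ∈ s, F i) = ∑ i ∈ s, euler (F i) := by
  simp [euler, Finset.mul_sum]

theorem euler_monomial (n : ℕ) (c : A) : euler (monomial n c) = n • monomial n c := by
  ext i
  rw [coeff_euler, coeff_smul, coeff_monomial]
  split_ifs with h
  · rw [h, nsmul_eq_mul]
  · simp

theorem euler_truncExp_monomial (p : ℕ) [CharP K p] [hp : Fact p.Prime] (n : ℕ) (c : A)
    (h : (monomial n c) ^ p = 0) :
    euler (truncExp K p (monomial n c)) = (n • monomial n c) * truncExp K p (monomial n c) := by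
  have hk : ∀ k, euler ((monomial n c) ^ k) = (k * n) • (monomial n c) ^ k := by
    intro k
    rw [monomial_pow, euler_monomial, mul_comm]
  obtain ⟨q, rfl⟩ : ∃ q, p = q + 1 := ⟨p - 1, by have := hp.out.pos; omega⟩
  rw [truncExp, euler_sum, Finset.sum_range_succ', Finset.mul_sum, Finset.sum_range_succ]
  -- Differentiation lowers the truncation degree by one; the missing top term is a multiple of the
  -- `p`-th power, hence zero.
  have h0 : (n • monomial n c) * ((q.factorial : K)⁻¹ • (monomial n c) ^ q) = 0 := by
    rw [mul_smul_comm, smul_mul_assoc, ← pow_succ', h, smul_zero, smul_zero]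
  rw [h0, add_zero, euler_smul, hk, zero_mul, zero_smul, smul_zero, add_zero]
  refine Finset.sum_congr rfl fun k hkq => ?_
  have hne := factorial_ne_zero_of_lt K (q + 1) (k := k + 1) (by simp at hkq; omega)
  rw [Nat.factorial_succ, Nat.cast_mul] at hne
  have h1 := left_ne_zero_of_mul hne
  have h2 := right_ne_zero_of_mul hne
  rw [euler_smul, hk, mul_smul_comm, smul_mul_assoc, ← pow_succ', mul_smul,
    ← Nat.cast_smul_eq_nsmul K (k + 1), smul_smul, Nat.factorial_succ, Nat.cast_mul]
  congr 1
  field_simp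

theorem eq_one_of_euler_eq_zero {M : Submodule K A} (p : ℕ) [CharP K p] [Fact p.Prime]
    (hM : M ^ p = ⊥) {F : A[X]} (hF : F ∈ gradedPoly M) (h0 : F.coeff 0 = 1)
    (hD : euler F = 0) : F = 1 := by
  rw [← sub_eq_zero]
  refine eq_zero_of_mem_gradedPoly hM (sub_mem hF (one_mem _)) ?_
  intro i hi
  rcases Nat.eq_zero_or_pos i with rfl | hpos
  · simp [h0]
  · have h1 := congrArg (fun F => F.coeff i) hD
    simp only [coeff_euler, coeff_zero] at h1
    have h2 : (i : K) ≠ 0 := by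
      rw [Ne, CharP.cast_eq_zero_iff K p]
      exact Nat.not_dvd_of_pos_of_lt hpos hi
    rw [← nsmul_eq_mul, ← Nat.cast_smul_eq_nsmul K, smul_eq_zero] at h1
    rw [coeff_sub, h1.resolve_left h2, coeff_one, if_neg (by omega), sub_zero]

/-- Evaluation at `1`. -/
def evalOne : A[X] →+* A := eval₂RingHom' (RingHom.id A) 1 (fun _ => Commute.one_right _)

theorem evalOne_monomial (n : ℕ) (c : A) : evalOne (monomial n c) = c := by
  simp [evalOne, eval₂RingHom']

theorem evalOne_smul (c : K) (F : A[X]) : evalOne (c • F) = c • evalOne F := by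
  have : c • F = C (algebraMap K A c) * F := by
    rw [Algebra.smul_def, Polynomial.algebraMap_apply]
  rw [this, map_mul, ← monomial_zero_left, evalOne_monomial, Algebra.smul_def]

theorem evalOne_truncExp (p : ℕ) (a : A[X]) :
    evalOne (truncExp K p a) = truncExp K p (evalOne a) := by
  simp [truncExp, evalOne_smul]

/-- The polynomials of order at least `n` with coefficients in `V` which lie in
`gradedPoly M`. -/
def gradedPolyOrder (M V : Submodule K A) (n : ℕ) : Submodule K A[X] where
  carrier := {F | F ∈ gradedPoly M ∧ (∀ i, F.coeff i ∈ V) ∧ ∀ i < n, F.coeff i = 0}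
  add_mem' := by
    rintro F G ⟨h1, h2, h3⟩ ⟨h4, h5, h6⟩
    refine ⟨add_mem h1 h4, fun i => ?_, fun i hi => ?_⟩
    · rw [coeff_add]; exact V.add_mem (h2 i) (h5 i)
    · rw [coeff_add, h3 i hi, h6 i hi, add_zero]
  zero_mem' := ⟨zero_mem _, fun i => by simp, fun i _ => by simp⟩
  smul_mem' := by
    rintro c F ⟨h1, h2, h3⟩
    refine ⟨Subalgebra.smul_mem _ h1 c, fun i => ?_, fun i hi => ?_⟩
    · rw [coeff_smul]; exact V.smul_mem c (h2 i)
    · rw [coeff_smul, h3 i hi, smul_zero]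

theorem lie_mem_gradedPolyOrder {M V W : Submodule K A} {n : ℕ}
    (hVW : ∀ x ∈ W, ∀ y ∈ V, ⁅x, y⁆ ∈ V) {a F : A[X]} (ha : a ∈ gradedPolyOrder M W 0)
    (hF : F ∈ gradedPolyOrder M V n) : ⁅a, F⁆ ∈ gradedPolyOrder M V n := by
  obtain ⟨h1, h2, -⟩ := ha
  obtain ⟨h3, h4, h5⟩ := hF
  rw [Ring.lie_def]
  refine ⟨sub_mem (mul_mem h1 h3) (mul_mem h3 h1), fun i => ?_, fun i hi => ?_⟩
  · rw [coeff_sub, coeff_mul, coeff_mul, ← Finset.Nat.sum_antidiagonal_swap, ← Finset.sum_sub_distrib]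
    exact V.sum_mem fun m _ => hVW _ (h2 _) _ (h4 _)
  · rw [coeff_sub, coeff_mul_eq_zero_of_lt (m := 0) (n := n) (by simp) h5 i (by omega),
      coeff_mul_eq_zero_of_lt (m := n) (n := 0) h5 (by simp) i (by omega), sub_zero]

theorem truncExp_conj_mem_gradedPolyOrder (p : ℕ) [CharP K p] [Fact p.Prime]
    {M V W : Submodule K A} {n : ℕ} (hM : M ^ p = ⊥)
    (hVW : ∀ x ∈ W, ∀ y ∈ V, ⁅x, y⁆ ∈ V) {a F : A[X]} (ha : a ∈ gradedPolyOrder M W 0)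
    (ha0 : a.coeff 0 = 0) (hF : F ∈ gradedPolyOrder M V n) :
    truncExp K p a * F * truncExp K p (-a) ∈ gradedPolyOrder M V n := by
  rw [truncExp_mul_mul_truncExp_neg p (pow_mul_mul_pow_eq_zero hM ha.1 ha0 hF.1)]
  refine Submodule.sum_mem _ fun k hk => Submodule.smul_mem _ _ ?_
  clear hk
  induction k with
  | zero => simpa using hF
  | succ k ih =>
    rw [pow_succ', Module.End.mul_apply, LieAlgebra.ad_apply]
    exact lie_mem_gradedPolyOrder hVW ha ih

/-- Descending recursion on `p - n`: splitting off a factor `exp (c X ^ n)` on the left raises the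
order of the logarithmic derivative `w`. Once `n ≥ p`, grading forces `w = 0` and `F = 1`. -/
theorem evalOne_mem_of_euler_eq (p : ℕ) [CharP K p] [Fact p.Prime]
    {M V : Submodule K A} (hM : M ^ p = ⊥) (hV : ∀ x ∈ V, ∀ y ∈ V, ⁅x, y⁆ ∈ V)
    (S : Submonoid A) (hS : ∀ x ∈ V, truncExp K p x ∈ S) (n : ℕ) (hn : 0 < n) (F w : A[X])
    (hF : F ∈ gradedPoly M) (hF0 : F.coeff 0 = 1) (hw : w ∈ gradedPolyOrder M V n)
    (hFw : euler F = w * F) : evalOne F ∈ S := by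
  by_cases hnp : p ≤ n
  · have : w = 0 := eq_zero_of_mem_gradedPoly hM hw.1 fun i hi => hw.2.2 i (by omega)
    rw [this, zero_mul] at hFw
    rw [eq_one_of_euler_eq_zero p hM hF hF0 hFw, map_one]
    exact one_mem _
  · have hn0 : (n : K) ≠ 0 := by
      rw [Ne, CharP.cast_eq_zero_iff K p]
      exact Nat.not_dvd_of_pos_of_lt hn (by omega)
    -- As `X d/dX` multiplies `c X ^ n` by `n`, this choice cancels the lowest term of `w`.
    set c : A := (n : K)⁻¹ • w.coeff n with hc
    set a : A[X] := monomial n c with ha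
    have hcV : c ∈ V := V.smul_mem _ (hw.2.1 n)
    have haV : a ∈ gradedPolyOrder M V n := by
      refine ⟨fun i => ?_, fun i => ?_, fun i hi => ?_⟩
      · rw [ha, coeff_monomial]
        split_ifs with h
        · rw [← h]; exact Submodule.smul_mem _ _ (hw.1 n)
        · exact zero_mem _
      · rw [ha, coeff_monomial]
        split_ifs with h
        · exact hcV
        · exact zero_mem _
      · rw [ha, coeff_monomial, if_neg (by omega)]
    have ha0 : a.coeff 0 = 0 := haV.2.2 0 hn
    have hna : -a = monomial n (-c) := by rw [ha, map_neg]
    have hap := pow_eq_zero_of_mem_gradedPoly hM haV.1 ha0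
    have hnaV : -a ∈ gradedPolyOrder M V n := neg_mem haV
    have hna0 : (-a).coeff 0 = 0 := hnaV.2.2 0 hn
    have hnap := pow_eq_zero_of_mem_gradedPoly hM hnaV.1 hna0
    have hFE : F = truncExp K p a * (truncExp K p (-a) * F) := by
      rw [← mul_assoc, truncExp_mul_truncExp_neg p hap, one_mul]
    have hD : euler (truncExp K p (-a)) = (n • (-a)) * truncExp K p (-a) := by
      rw [hna]
      exact euler_truncExp_monomial p n (-c) (by rw [← hna]; exact hnap)
    rw [hFE, map_mul, evalOne_truncExp, ha, evalOne_monomial]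
    refine mul_mem (hS c hcV) ?_
    -- The logarithmic derivative of `exp (-a) F` is `exp (-a) (w - n a) exp a`; conjugation keeps
    -- its coefficients in `V` and its order at least `n + 1`.
    refine evalOne_mem_of_euler_eq p hM hV S hS (n + 1) (by omega) _
      (truncExp K p (-a) * (w - n • a) * truncExp K p a)
      (mul_mem (truncExp_mem_gradedPoly p hnaV.1) hF) ?_ ?_ ?_
    · rw [mul_coeff_zero, hF0, truncExp_coeff_zero p hna0, one_mul]
    · have := truncExp_conj_mem_gradedPolyOrder p (n := n + 1) (F := w - n • a) hM hV
        (a := -a) ⟨hnaV.1, hnaV.2.1, by simp⟩ hna0 ?_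
      · rwa [neg_neg] at this
      · have h1 : w - n • a ∈ gradedPolyOrder M V n :=
          sub_mem hw (nsmul_mem haV n)
        refine ⟨h1.1, h1.2.1, fun i hi => ?_⟩
        rcases Nat.lt_succ_iff_lt_or_eq.1 hi with h | rfl
        · exact h1.2.2 i h
        · rw [coeff_sub, coeff_smul, ha, coeff_monomial, if_pos rfl, hc,
            ← Nat.cast_smul_eq_nsmul K, smul_smul, mul_inv_cancel₀ hn0, one_smul, sub_self]
    · rw [euler_mul, hD, hFw]
      have h1 : truncExp K p (-a) * (w - n • a) * truncExp K p a * (truncExp K p (-a) * F) =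
          truncExp K p (-a) * (w - n • a) * F := by
        rw [mul_assoc, ← mul_assoc (truncExp K p a), truncExp_mul_truncExp_neg p hap, one_mul]
      have h2 : (n • (-a)) * truncExp K p (-a) = -(truncExp K p (-a) * (n • a)) := by
        have h3 : Commute (n • (-a)) (truncExp K p (-a)) :=
          (commute_truncExp p (Commute.refl (-a))).smul_left n
        rw [h3.eq, smul_neg, mul_neg]
      rw [h1, h2]
      noncomm_ring
  termination_by p - n

/-- A replacement for the Campbell–Hausdorff formula: for an ideal `V` of the Lie algebra `W`,
`exp (-x) exp (x + y)` with `x ∈ W`, `y ∈ V` is a product of exponentials of elements of `V`. -/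
theorem truncExp_neg_mul_truncExp_add_mem (p : ℕ) [CharP K p] [Fact p.Prime]
    {V W : Submodule K A} (hW : W ^ p = ⊥) (hVW : V ≤ W) (hV : ∀ x ∈ W, ∀ y ∈ V, ⁅x, y⁆ ∈ V)
    (S : Submonoid A) (hS : ∀ x ∈ V, truncExp K p x ∈ S) {x y : A} (hx : x ∈ W) (hy : y ∈ V) :
    truncExp K p (-x) * truncExp K p (x + y) ∈ S := by
  have key : ∀ (U : Submodule K A), U ≤ W → ∀ z ∈ U, monomial 1 z ∈ gradedPolyOrder W U 1 := by
    intro U hU z hz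
    refine ⟨fun i => ?_, fun i => ?_, fun i hi => ?_⟩ <;> rw [coeff_monomial]
    · split_ifs with h
      · rw [← h, pow_one]; exact hU hz
      · exact zero_mem _
    · split_ifs with h
      · exact hz
      · exact zero_mem _
    · rw [if_neg (by omega)]
  have h0 : ∀ z : A, (monomial 1 z : A[X]).coeff 0 = 0 := fun z => by
    rw [coeff_monomial, if_neg (by omega)]
  have hpow : ∀ z ∈ W, (monomial 1 z : A[X]) ^ p = 0 := fun z hz =>
    pow_eq_zero_of_mem_gradedPoly hW (key W le_rfl z hz).1 (h0 z)
  have hnx : -x ∈ W := neg_mem hx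
  have hxy : x + y ∈ W := add_mem hx (hVW hy)
  set a : A[X] := monomial 1 x with ha
  have hna : (monomial 1 (-x) : A[X]) = -a := by rw [ha, map_neg]
  have hxW := key W le_rfl _ hnx
  have hev : evalOne (truncExp K p (monomial 1 (-x)) * truncExp K p (monomial 1 (x + y))) =
      truncExp K p (-x) * truncExp K p (x + y) := by
    rw [map_mul, evalOne_truncExp, evalOne_truncExp, evalOne_monomial, evalOne_monomial]
  rw [← hev]
  -- In the derivative of `exp (-xX) exp ((x + y)X)` the `x` terms cancel, leaving the conjugate of
  -- `yX` by `exp (-xX)`. Its coefficients lie in `V` because `V` is an ideal.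
  refine evalOne_mem_of_euler_eq p hW (fun u hu v hv => hV u (hVW hu) v hv) S hS 1 one_pos _
    (truncExp K p (-a) * monomial 1 y * truncExp K p a)
    (mul_mem (truncExp_mem_gradedPoly p hxW.1)
      (truncExp_mem_gradedPoly p (key W le_rfl _ hxy).1)) ?_ ?_ ?_
  · rw [mul_coeff_zero, truncExp_coeff_zero p (h0 _), truncExp_coeff_zero p (h0 _), one_mul]
  · have := truncExp_conj_mem_gradedPolyOrder p (n := 1) hW hV (a := -a)
      (F := monomial 1 y) ?_ ?_ (key V hVW y hy)
    · rwa [neg_neg] at this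
    · rw [← hna]; exact ⟨hxW.1, hxW.2.1, by simp⟩
    · rw [← hna]; exact h0 _
  · rw [euler_mul, euler_truncExp_monomial p _ _ (hpow _ hnx),
      euler_truncExp_monomial p _ _ (hpow _ hxy), map_add, ← ha, hna, one_smul, one_smul]
    have h1 : truncExp K p (-a) * monomial 1 y * truncExp K p a *
        (truncExp K p (-a) * truncExp K p (a + monomial 1 y)) =
        truncExp K p (-a) * monomial 1 y * truncExp K p (a + monomial 1 y) := by
      rw [mul_assoc, ← mul_assoc (truncExp K p a),
        truncExp_mul_truncExp_neg p (hpow x hx), one_mul]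
    rw [h1, (commute_truncExp p (Commute.refl (-a))).eq]
    noncomm_ring

end GradedPolynomials

/-! ### Exponentials of a nilpotent Lie algebra form a group -/

section ExpClosed

variable {K : Type*} [Field K] {A : Type*} [Ring A] [Algebra K A]

theorem pow_eq_bot_of_le {W : Submodule K A} {p n : ℕ} (hW : W ^ p = ⊥) (h : p ≤ n) :
    W ^ n = ⊥ := by
  rw [← Nat.add_sub_cancel' h, pow_add, hW, Submodule.bot_mul]

theorem pow_eq_bot_mono {V W : Submodule K A} {p : ℕ} (h : V ≤ W) (hW : W ^ p = ⊥) :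
    V ^ p = ⊥ :=
  le_bot_iff.1 ((pow_le_pow_left' h p).trans hW.le)

theorem pow_mul_pow_eq_zero {W : Submodule K A} {p : ℕ} (hW : W ^ p = ⊥) {x y : A} (hx : x ∈ W)
    (hy : y ∈ W) (i j : ℕ) (h : p ≤ i + j) : x ^ i * y ^ j = 0 := by
  rw [← Submodule.mem_bot K, ← pow_eq_bot_of_le hW h, pow_add]
  exact Submodule.mul_mem_mul (Submodule.pow_mem_pow _ hx i) (Submodule.pow_mem_pow _ hy j)

theorem pow_mul_mul_pow_eq_zero' {W : Submodule K A} {p : ℕ} (hW : W ^ p = ⊥) {x y w : A}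
    (hx : x ∈ W) (hw : w ∈ W) (hy : y ∈ W) (i j : ℕ) (h : p ≤ i + j) :
    x ^ i * w * y ^ j = 0 := by
  rw [← Submodule.mem_bot K, ← pow_eq_bot_of_le hW (h.trans (Nat.le_succ _) : p ≤ i + j + 1),
    add_right_comm, pow_add, pow_succ]
  exact Submodule.mul_mem_mul (Submodule.mul_mem_mul (Submodule.pow_mem_pow _ hx i) hw)
    (Submodule.pow_mem_pow _ hy j)

theorem pow_eq_zero_of_mem {W : Submodule K A} {p : ℕ} (hW : W ^ p = ⊥) {x : A} (hx : x ∈ W) :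
    x ^ p = 0 := by
  simpa using pow_mul_pow_eq_zero hW hx hx p 0 le_rfl

theorem ad_pow_eq_zero {W : Submodule K A} {p : ℕ} (hW : W ^ p = ⊥) {x y : A} (hx : x ∈ W)
    (hy : y ∈ W) : ((LieAlgebra.ad K A x) ^ p) y = 0 := by
  rw [ad_pow_apply_eq_sum]
  refine Finset.sum_eq_zero fun m hm => ?_
  rw [pow_mul_mul_pow_eq_zero' hW hx hy (neg_mem hx) _ _
    (Finset.HasAntidiagonal.mem_antidiagonal.1 hm).ge, smul_zero]

theorem truncExp_conj_eq_sum (p : ℕ) [CharP K p] [Fact p.Prime] {W : Submodule K A}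
    (hW : W ^ p = ⊥) {x y : A} (hx : x ∈ W) (hy : y ∈ W) :
    truncExp K p x * y * truncExp K p (-x) =
      ∑ k ∈ Finset.range p, (k.factorial : K)⁻¹ • ((LieAlgebra.ad K A x) ^ k) y :=
  truncExp_mul_mul_truncExp_neg p (pow_mul_mul_pow_eq_zero' hW hx hy hx)

theorem truncExp_conj_mem (p : ℕ) [CharP K p] [Fact p.Prime] {V W : Submodule K A}
    (hW : W ^ p = ⊥) (hVW : V ≤ W) (hV : ∀ x ∈ W, ∀ y ∈ V, ⁅x, y⁆ ∈ V) {x y : A} (hx : x ∈ W)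
    (hy : y ∈ V) : truncExp K p x * y * truncExp K p (-x) ∈ V := by
  rw [truncExp_conj_eq_sum p hW hx (hVW hy)]
  refine Submodule.sum_mem _ fun k hk => Submodule.smul_mem _ _ ?_
  clear hk
  induction k with
  | zero => simpa using hy
  | succ k ih =>
    rw [pow_succ', Module.End.mul_apply, LieAlgebra.ad_apply]
    exact hV _ hx _ ih

/-- If `exp x = exp y`, then `exp y` commutes with `x`, so `exp (ad y)` fixes `x` and `[y, x] = 0`
by nilpotency. Hence `exp (x - y) = 1`, and the same argument for left multiplication by `x - y`,
applied to `1`, gives `x = y`. -/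
theorem truncExp_injOn (p : ℕ) [CharP K p] [Fact p.Prime] {W : Submodule K A} (hW : W ^ p = ⊥) :
    Set.InjOn (truncExp K p) (W : Set A) := by
  intro x hx y hy hxy
  have hyp := pow_eq_zero_of_mem hW hy
  have h1 : truncExp K p y * x * truncExp K p (-y) = x := by
    rw [← hxy, ← (commute_truncExp p (Commute.refl x)).eq, mul_assoc, hxy,
      truncExp_mul_truncExp_neg p hyp, mul_one]
  rw [truncExp_conj_eq_sum p hW hy hx] at h1
  have h2 := apply_eq_zero_of_sum_pow_apply_eq p _ _ p (ad_pow_eq_zero hW hy hx) h1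
  have h3 : Commute x (-y) := by
    rw [LieAlgebra.ad_apply, Ring.lie_def, sub_eq_zero] at h2
    exact Commute.neg_right h2.symm
  have h4 : truncExp K p (x + -y) = 1 := by
    rw [← truncExp_mul_truncExp p h3 (pow_mul_pow_eq_zero hW hx (neg_mem hy)), hxy,
      truncExp_mul_truncExp_neg p hyp]
  have h5 := apply_eq_zero_of_sum_pow_apply_eq (K := K) p (LinearMap.mulLeft K (x + -y)) 1 p
    (by rw [LinearMap.pow_mulLeft, pow_eq_zero_of_mem hW (add_mem hx (neg_mem hy))]; simp)
    (by simpa [truncExp, LinearMap.pow_mulLeft] using h4)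
  simpa [add_neg_eq_zero] using h5

/-- Exponentials of elements of `W` are closed under multiplication. -/
def ExpClosed (p : ℕ) (W : Submodule K A) : Prop :=
  ∀ x ∈ W, ∀ y ∈ W, ∃ z ∈ W, truncExp K p x * truncExp K p y = truncExp K p z

theorem exists_truncExp_add_eq_mul (p : ℕ) [CharP K p] [Fact p.Prime] {V W : Submodule K A}
    (hW : W ^ p = ⊥) (hVW : V ≤ W) (hV : ∀ x ∈ W, ∀ y ∈ V, ⁅x, y⁆ ∈ V) (hc : ExpClosed p V)
    {x y : A} (hx : x ∈ W) (hy : y ∈ V) :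
    ∃ z ∈ V, truncExp K p (x + y) = truncExp K p x * truncExp K p z := by
  let S : Submonoid A :=
    { carrier := truncExp K p '' V
      mul_mem' := by
        rintro _ _ ⟨a, ha, rfl⟩ ⟨b, hb, rfl⟩
        obtain ⟨z, hz, h⟩ := hc a ha b hb
        exact ⟨z, hz, h.symm⟩
      one_mem' := ⟨0, V.zero_mem, truncExp_zero p⟩ }
  obtain ⟨z, hz, h⟩ := truncExp_neg_mul_truncExp_add_mem p hW hVW hV S
    (fun v hv => ⟨v, hv, rfl⟩) hx hy
  exact ⟨z, hz, by
    rw [h, ← mul_assoc, truncExp_mul_truncExp_neg p (pow_eq_zero_of_mem hW hx), one_mul]⟩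

/-- Converse of `exists_truncExp_add_eq_mul`. The map `y ↦ z` it provides is injective on `V`
because `exp` is, hence surjective since `V` is finite. -/
theorem exists_truncExp_mul_eq_add [Finite A] (p : ℕ) [CharP K p] [Fact p.Prime]
    {V W : Submodule K A} (hW : W ^ p = ⊥) (hVW : V ≤ W) (hV : ∀ x ∈ W, ∀ y ∈ V, ⁅x, y⁆ ∈ V)
    (hc : ExpClosed p V) {x z : A} (hx : x ∈ W) (hz : z ∈ V) :
    ∃ y ∈ V, truncExp K p x * truncExp K p z = truncExp K p (x + y) := by
  have h1 : ∀ y : V, ∃ z : V, truncExp K p (x + y) = truncExp K p x * truncExp K p (z : A) := by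
    intro y
    obtain ⟨z, hz, h⟩ := exists_truncExp_add_eq_mul p hW hVW hV hc hx y.2
    exact ⟨⟨z, hz⟩, h⟩
  choose φ hφ using h1
  have hinj : Function.Injective φ := by
    intro a b hab
    have h2 := (hφ a).trans ((congrArg _ (by rw [hab])).trans (hφ b).symm)
    have h3 := truncExp_injOn p hW (add_mem hx (hVW a.2)) (add_mem hx (hVW b.2)) h2
    exact Subtype.ext (add_left_cancel h3)
  obtain ⟨y, hy⟩ := (Finite.injective_iff_surjective.1 hinj) ⟨z, hz⟩
  exact ⟨y, y.2, by rw [hφ y, hy]⟩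

theorem truncExp_conj (p : ℕ) {u v : A} (hvu : v * u = 1) (huv : u * v = 1) (y : A) :
    truncExp K p (u * y * v) = u * truncExp K p y * v := by
  have : ∀ k, (u * y * v) ^ k = u * y ^ k * v := by
    intro k
    induction k with
    | zero => simp [huv]
    | succ k ih =>
      rw [pow_succ, ih, pow_succ]
      simp only [mul_assoc]
      rw [← mul_assoc v, hvu, one_mul]
  simp only [truncExp, this, Finset.mul_sum, Finset.sum_mul, mul_smul_comm, smul_mul_assoc]

/-- Split off `exp (a x)` and `exp (b x)`, then move `exp (b x)` to the left past an element of `exp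
V`, which `exp W` normalizes. The coefficient of `x` is additive; everything else stays in `V`. -/
theorem exists_truncExp_mul_truncExp_eq [Finite A] (p : ℕ) [CharP K p] [Fact p.Prime]
    {V W : Submodule K A} (hW : W ^ p = ⊥) (hVW : V ≤ W) (hV : ∀ x ∈ W, ∀ y ∈ V, ⁅x, y⁆ ∈ V)
    (hc : ExpClosed p V) {x y z : A} (hx : x ∈ W) (hy : y ∈ V) (hz : z ∈ V) (a b : K) :
    ∃ t ∈ V, truncExp K p (a • x + y) * truncExp K p (b • x + z) =
      truncExp K p ((a + b) • x + t) := by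
  have hax : a • x ∈ W := W.smul_mem a hx
  have hbx : b • x ∈ W := W.smul_mem b hx
  obtain ⟨y', hy', h1⟩ := exists_truncExp_add_eq_mul p hW hVW hV hc hax hy
  obtain ⟨z', hz', h2⟩ := exists_truncExp_add_eq_mul p hW hVW hV hc hbx hz
  have hb1 := truncExp_mul_truncExp_neg (K := K) p (pow_eq_zero_of_mem hW hbx)
  have hb2 := truncExp_neg_mul_truncExp (K := K) p (pow_eq_zero_of_mem hW hbx)
  have h3 := truncExp_conj_mem p hW hVW hV (neg_mem hbx) hy'
  rw [neg_neg] at h3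
  obtain ⟨s, hs, h4⟩ := hc _ h3 _ hz'
  obtain ⟨t, ht, h5⟩ := exists_truncExp_mul_eq_add p hW hVW hV hc (W.smul_mem (a + b) hx) hs
  refine ⟨t, ht, ?_⟩
  rw [← h5, ← h4, truncExp_conj p hb1 hb2, h1, h2, add_smul,
    ← truncExp_mul_truncExp p (((Commute.refl x).smul_left a).smul_right b)
      (pow_mul_pow_eq_zero hW hax hbx)]
  simp only [mul_assoc]
  rw [← mul_assoc (truncExp K p (b • x)) (truncExp K p (-(b • x))), hb1, one_mul]

/-- A proper subspace of a finite-dimensional space lies in a hyperplane. -/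
theorem exists_hyperplane {L : Type*} [AddCommGroup L] [Module K L] [FiniteDimensional K L]
    {C I : Submodule K L} (h : C < I) :
    ∃ V, C ≤ V ∧ V < I ∧ ∃ x ∈ I, ∀ y ∈ I, ∃ a : K, ∃ v ∈ V, y = a • x + v := by
  obtain ⟨V, hV, hcov⟩ := exists_le_covBy_of_lt h
  obtain ⟨x, hxI, hxV⟩ := SetLike.exists_of_lt hcov.lt
  refine ⟨V, hV, hcov.lt, x, hxI, fun y hy => ?_⟩
  have h1 : V < Submodule.span K {x} ⊔ V := by
    refine lt_of_le_of_ne le_sup_right fun h => hxV ?_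
    rw [h]
    exact Submodule.mem_sup_left (Submodule.mem_span_singleton_self x)
  have h2 : Submodule.span K {x} ⊔ V = I :=
    (hcov.eq_or_eq h1.le (sup_le ((Submodule.span_singleton_le_iff_mem _ _).2 hxI) hcov.le)).resolve_left
      h1.ne'
  rw [← h2, Submodule.mem_sup] at hy
  obtain ⟨_, hs, v, hv, rfl⟩ := hy
  obtain ⟨a, rfl⟩ := Submodule.mem_span_singleton.1 hs
  exact ⟨a, v, hv, rfl⟩

/-- The span of the brackets of elements of `W` with elements of `J`. -/
def bracketSpan {L : Type*} [LieRing L] [LieAlgebra K L] (W J : Submodule K L) : Submodule K L :=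
  Submodule.span K {z | ∃ x ∈ W, ∃ y ∈ J, ⁅x, y⁆ = z}

/-- Iterating `J ≤ [W, J]` pushes `J` into every power of `W`. This is the form in which nilpotency
is used. -/
theorem eq_bot_of_le_bracketSpan {W J : Submodule K A} {p : ℕ} (hW : W ^ p = ⊥) (hJ : J ≤ W)
    (h : J ≤ bracketSpan W J) : J = ⊥ := by
  have : ∀ n, J ≤ W ^ (n + 1) := by
    intro n
    induction n with
    | zero => simpa using hJ
    | succ n ih =>
      refine h.trans (Submodule.span_le.2 ?_)
      rintro _ ⟨x, hx, y, hy, rfl⟩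
      rw [Ring.lie_def]
      refine sub_mem ?_ ?_
      · rw [pow_succ']; exact Submodule.mul_mem_mul hx (ih hy)
      · rw [pow_succ]; exact Submodule.mul_mem_mul (ih hy) hx
  exact le_bot_iff.1 ((this p).trans (pow_eq_bot_of_le hW (Nat.le_succ p)).le)

/-- By nilpotency `[W, W] ≠ W`, so some hyperplane `V` of `W` contains `[W, W]`. It is an ideal, and
the induction hypothesis for `V` extends to `W = K x + V`. -/
theorem expClosed [Finite A] (p : ℕ) [CharP K p] [Fact p.Prime] (W : Submodule K A)
    (hW : W ^ p = ⊥) (hlie : ∀ x ∈ W, ∀ y ∈ W, ⁅x, y⁆ ∈ W) : ExpClosed p W := by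
  have : Module.Finite K A := Module.Finite.of_finite
  induction W using WellFoundedLT.induction with
  | ind W ih =>
    by_cases hbot : W = ⊥
    · subst hbot
      intro x hx y hy
      rw [Submodule.mem_bot] at hx hy
      exact ⟨0, zero_mem _, by simp [hx, hy]⟩
    · have hle : bracketSpan W W ≤ W := by
        refine Submodule.span_le.2 ?_
        rintro _ ⟨x, hx, y, hy, rfl⟩
        exact hlie x hx y hy
      have hlt : bracketSpan W W < W :=
        lt_of_le_of_ne hle fun h => hbot (eq_bot_of_le_bracketSpan hW le_rfl h.ge)
      obtain ⟨V, hCV, hVW, x, hx, hdec⟩ := exists_hyperplane hlt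
      have hV : ∀ x ∈ W, ∀ y ∈ V, ⁅x, y⁆ ∈ V := fun x hx y hy =>
        hCV (Submodule.subset_span ⟨x, hx, y, hVW.le hy, rfl⟩)
      have hVp : V ^ p = ⊥ := pow_eq_bot_mono hVW.le hW
      have hc := ih V hVW hVp fun x hx y hy => hV x (hVW.le hx) y hy
      intro u hu v hv
      obtain ⟨a, y, hy, rfl⟩ := hdec u hu
      obtain ⟨b, z, hz, rfl⟩ := hdec v hv
      obtain ⟨t, ht, h⟩ := exists_truncExp_mul_truncExp_eq p hW hVW.le hV hc hx hy hz a b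
      exact ⟨_, add_mem (W.smul_mem _ hx) (hVW.le ht), h⟩

/-- A linear form which vanishes on brackets is additive on products of exponentials. -/
theorem apply_eq_add_of_truncExp_mul_eq [Finite A] (p : ℕ) [CharP K p] [Fact p.Prime]
    {W : Submodule K A} (hW : W ^ p = ⊥) (hlie : ∀ x ∈ W, ∀ y ∈ W, ⁅x, y⁆ ∈ W) (f : A →ₗ[K] K)
    (hf : ∀ x ∈ W, ∀ y ∈ W, f ⁅x, y⁆ = 0) {x y z : A} (hx : x ∈ W) (hy : y ∈ W) (hz : z ∈ W)
    (h : truncExp K p x * truncExp K p y = truncExp K p z) : f z = f x + f y := by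
  by_cases hf0 : ∀ w ∈ W, f w = 0
  · rw [hf0 x hx, hf0 y hy, hf0 z hz, add_zero]
  · push Not at hf0
    obtain ⟨w, hw, hfw⟩ := hf0
    -- The kernel of `f` in `W` contains all brackets, so it is an ideal of codimension one. The
    -- coefficient of `w`, which is additive under products, is then `f / f w`.
    set V : Submodule K A := W ⊓ LinearMap.ker f with hVdef
    have hVW : V ≤ W := inf_le_left
    have hV : ∀ x ∈ W, ∀ y ∈ V, ⁅x, y⁆ ∈ V := fun x hx y hy =>
      ⟨hlie x hx y hy.1, hf x hx y hy.1⟩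
    have hVp : V ^ p = ⊥ := pow_eq_bot_mono hVW hW
    have hc := expClosed p V hVp fun x hx y hy => hV x (hVW hx) y hy
    have hdec : ∀ u ∈ W, ∃ v ∈ V, u = (f u / f w) • w + v := fun u hu =>
      ⟨u - (f u / f w) • w, ⟨sub_mem hu (W.smul_mem _ hw), by simp [hfw]⟩, by abel⟩
    obtain ⟨x', hx', hxe⟩ := hdec x hx
    obtain ⟨y', hy', hye⟩ := hdec y hy
    obtain ⟨t, ht, h1⟩ := exists_truncExp_mul_truncExp_eq p hW hVW hV hc hw hx' hy'
      (f x / f w) (f y / f w)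
    rw [← hxe, ← hye, h] at h1
    have h2 := truncExp_injOn p hW hz (add_mem (W.smul_mem _ hw) (hVW ht)) h1
    have ht0 : f t = 0 := ht.2
    rw [h2, map_add, map_smul, ht0, smul_eq_mul]
    field_simp
    ring

end ExpClosed

/-! ### Polarizations of linear forms -/

section Polarization

variable {K : Type*} [Field K] {L : Type*} [LieRing L] [LieAlgebra K L]

/-- The alternating form `l ⁅x, y⁆` on a Lie algebra. -/
def bracketForm (l : Module.Dual K L) : LinearMap.BilinForm K L :=
  (LieAlgebra.ad K L : L →ₗ[K] Module.End K L).compr₂ l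

@[simp]
theorem bracketForm_apply (l : Module.Dual K L) (x y : L) : bracketForm l x y = l ⁅x, y⁆ := rfl

theorem bracketForm_isAlt (l : Module.Dual K L) : (bracketForm l).IsAlt := fun x => by simp

theorem apply_lie_eq_neg (l : Module.Dual K L) (x y : L) : l ⁅x, y⁆ = -l ⁅y, x⁆ := by
  rw [← lie_skew, map_neg]

theorem apply_lie_lie_eq (l : Module.Dual K L) (x y z : L) :
    l ⁅⁅x, y⁆, z⁆ = l ⁅x, ⁅y, z⁆⁆ - l ⁅y, ⁅x, z⁆⁆ := by
  rw [leibniz_lie x y z, map_add, add_sub_cancel_right]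

/-- The image of `V → V*` under a form is the annihilator of its radical, by finite-dimensional
duality. -/
theorem exists_mem_apply_lie_eq [FiniteDimensional K L] (l φ : Module.Dual K L)
    {V : Submodule K L}
    (h : ∀ v ∈ V, (∀ z ∈ V, l ⁅v, z⁆ = 0) → φ v = 0) : ∃ y ∈ V, ∀ z ∈ V, l ⁅y, z⁆ = φ z := by
  let f : V →ₗ[K] Module.Dual K V := (bracketForm l).domRestrict₁₂ V V
  have h1 : φ.domRestrict V ∈ (LinearMap.range f).dualCoannihilator.dualAnnihilator := by
    rw [Submodule.mem_dualAnnihilator]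
    intro v hv
    rw [Submodule.mem_dualCoannihilator] at hv
    refine h v v.2 fun z hz => ?_
    have := hv (f ⟨z, hz⟩) ⟨_, rfl⟩
    rw [apply_lie_eq_neg, neg_eq_zero]
    exact this
  rw [Subspace.dualCoannihilator_dualAnnihilator_eq] at h1
  obtain ⟨y, hy⟩ := h1
  exact ⟨y, y.2, fun z hz => LinearMap.congr_fun hy ⟨z, hz⟩⟩

/-- Vergne's construction, by induction on the ideal `I`: to the `q` of a hyperplane ideal `V`
containing `[L, I]`, add the radical `R` of `l` on `I`. The final clause strengthens the induction:
it gives `[R, q] ⊆ q`, which makes `q + R` a subalgebra. -/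
theorem exists_isotropic_of_ideal [FiniteDimensional K L]
    (hnil : ∀ J : Submodule K L, J ≤ bracketSpan ⊤ J → J = ⊥) (l : Module.Dual K L)
    (I : Submodule K L) (hI : ∀ x : L, ∀ y ∈ I, ⁅x, y⁆ ∈ I) :
    ∃ q ≤ I, (∀ x ∈ q, ∀ y ∈ q, l ⁅x, y⁆ = 0) ∧ (∀ x ∈ I, (∀ y ∈ q, l ⁅x, y⁆ = 0) → x ∈ q) ∧
      (∀ x ∈ q, ∀ y ∈ q, ⁅x, y⁆ ∈ q) ∧
      ∀ y : L, (∀ z ∈ I, l ⁅y, z⁆ = 0) → ∀ x ∈ q, ⁅y, x⁆ ∈ q := by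
  induction I using WellFoundedLT.induction with
  | ind I ih =>
  by_cases hbot : I = ⊥
  · refine ⟨⊥, bot_le, ?_⟩
    subst hbot
    simp
  have hle : bracketSpan ⊤ I ≤ I := by
    refine Submodule.span_le.2 ?_
    rintro _ ⟨x, -, y, hy, rfl⟩
    exact hI x y hy
  obtain ⟨V, hCV, hVI, x₀, hx₀, hdec⟩ :=
    exists_hyperplane (lt_of_le_of_ne hle fun h => hbot (hnil I h.ge))
  have hIV : ∀ x : L, ∀ y ∈ I, ⁅x, y⁆ ∈ V := fun x y hy =>
    hCV (Submodule.subset_span ⟨x, trivial, y, hy, rfl⟩)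
  obtain ⟨q, hqV, h1, h2, h3, h4⟩ := ih V hVI fun x y hy => hIV x y (hVI.le hy)
  let R : Submodule K L :=
    { carrier := {x | x ∈ I ∧ ∀ z ∈ I, l ⁅x, z⁆ = 0}
      add_mem' := fun {a b} ha hb => ⟨add_mem ha.1 hb.1, fun z hz => by
        rw [add_lie, map_add, ha.2 z hz, hb.2 z hz, add_zero]⟩
      zero_mem' := ⟨zero_mem _, fun z _ => by simp⟩
      smul_mem' := fun c x hx => ⟨I.smul_mem c hx.1, fun z hz => by
        rw [smul_lie, map_smul, hx.2 z hz, smul_zero]⟩ }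
  have hqI : q ≤ I := hqV.trans hVI.le
  have hRI : R ≤ I := fun x hx => hx.1
  have hR : ∀ x ∈ R, ∀ z ∈ I, l ⁅x, z⁆ = 0 := fun x hx => hx.2
  have hRlie : ∀ y : L, (∀ z ∈ I, l ⁅y, z⁆ = 0) → ∀ x ∈ R, ⁅y, x⁆ ∈ R := fun y hy x hx =>
    ⟨hI y x hx.1, fun z hz => by
      rw [apply_lie_lie_eq, hy _ (hI x z hz), hR x hx _ (hI y z hz), sub_zero]⟩
  refine ⟨q ⊔ R, sup_le hqI hRI, ?_, ?_, ?_, ?_⟩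
  · intro x hx y hy
    obtain ⟨a, ha, r, hr, rfl⟩ := Submodule.mem_sup.1 hx
    obtain ⟨b, hb, s, hs, rfl⟩ := Submodule.mem_sup.1 hy
    rw [add_lie, map_add, hR r hr _ (sup_le hqI hRI hy), lie_add, map_add, h1 a ha b hb,
      apply_lie_eq_neg l a s, hR s hs _ (hqI ha)]
    simp
  · intro x hxI hx
    by_cases hxV : x ∈ V
    · exact Submodule.mem_sup_left (h2 x hxV fun y hy => hx y (Submodule.mem_sup_left hy))
    · have hVmem : ∀ z ∈ I, ∃ a : K, ∃ v ∈ V, z = a • x + v := by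
        obtain ⟨b, w, hw, hxe⟩ := hdec x hxI
        have hb : b ≠ 0 := by
          rintro rfl
          rw [zero_smul, zero_add] at hxe
          exact hxV (hxe ▸ hw)
        intro z hz
        obtain ⟨a, v, hv, rfl⟩ := hdec z hz
        refine ⟨a * b⁻¹, v - (a * b⁻¹) • w, sub_mem hv (V.smul_mem _ hw), ?_⟩
        rw [hxe, smul_add, smul_smul, inv_mul_cancel_right₀ hb]
        abel
      -- For `x` outside `V`, the radical of `l` on `V` lies in `q`, so `l ⁅x, ·⁆` kills it and is
      -- represented on `V` by some `y ∈ V`. Then `y ∈ q`, and `x - y` is orthogonal to both `V` and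
      -- `x`, hence to `I = K x + V`.
      obtain ⟨y, hyV, hy⟩ := exists_mem_apply_lie_eq l (bracketForm l x) (V := V) (by
        intro v hv hvz
        refine hx v (Submodule.mem_sup_left (h2 v hv fun z hz => hvz z (hqV hz))))
      have hyq : y ∈ q := h2 y hyV fun z hz => by
        rw [hy z (hqV hz)]
        exact hx z (Submodule.mem_sup_left hz)
      have hxy : x - y ∈ R := by
        refine ⟨sub_mem hxI (hqI hyq), fun z hz => ?_⟩
        obtain ⟨a, v, hv, rfl⟩ := hVmem z hz
        have e1 := hy v hv
        have e2 : l ⁅x, y⁆ = 0 := hx y (Submodule.mem_sup_left hyq)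
        rw [bracketForm_apply] at e1
        simp [sub_lie, e1, e2]
      rw [← add_sub_cancel y x]
      exact Submodule.add_mem_sup hyq hxy
  · intro x hx y hy
    obtain ⟨a, ha, r, hr, rfl⟩ := Submodule.mem_sup.1 hx
    obtain ⟨b, hb, s, hs, rfl⟩ := Submodule.mem_sup.1 hy
    have hRq : ∀ r ∈ R, ∀ a ∈ q, ⁅r, a⁆ ∈ q := fun r hr a ha =>
      h4 r (fun z hz => hR r hr z (hVI.le hz)) a ha
    rw [add_lie, lie_add, lie_add]
    refine add_mem (add_mem (Submodule.mem_sup_left (h3 a ha b hb)) (Submodule.mem_sup_left ?_))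
      (add_mem (Submodule.mem_sup_left (hRq r hr b hb))
        (Submodule.mem_sup_right (hRlie r (hR r hr) s hs)))
    rw [← lie_skew]
    exact neg_mem (hRq s hs a ha)
  · intro y hy x hx
    obtain ⟨a, ha, r, hr, rfl⟩ := Submodule.mem_sup.1 hx
    rw [lie_add]
    exact add_mem (Submodule.mem_sup_left (h4 y (fun z hz => hy z (hVI.le hz)) a ha))
      (Submodule.mem_sup_right (hRlie y hy r hr))

/-- Every linear form on a nilpotent Lie algebra has a polarization. -/
theorem exists_isPolarization [FiniteDimensional K L]
    (hnil : ∀ J : Submodule K L, J ≤ bracketSpan ⊤ J → J = ⊥) (l : Module.Dual K L) :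
    ∃ q : LieSubalgebra K L, IsPolarization l q := by
  obtain ⟨q, -, h1, h2, h3, -⟩ := exists_isotropic_of_ideal hnil l ⊤ (by simp)
  refine ⟨{ q with lie_mem' := fun {x y} hx hy => h3 x hx y hy }, h1, fun W hW hle x hx => ?_⟩
  exact h2 x trivial fun y hy => hW x hx y (hle hy)

theorem IsPolarization.mem_of_forall {l : Module.Dual K L} {q : LieSubalgebra K L}
    (h : IsPolarization l q) {x : L} (hx : ∀ y ∈ q, l ⁅x, y⁆ = 0) : x ∈ q := by
  have h1 : IsIsotropic l (q.toSubmodule ⊔ Submodule.span K {x}) := by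
    intro a ha b hb
    obtain ⟨a', ha', _, hs, rfl⟩ := Submodule.mem_sup.1 ha
    obtain ⟨b', hb', _, ht, rfl⟩ := Submodule.mem_sup.1 hb
    obtain ⟨s, rfl⟩ := Submodule.mem_span_singleton.1 hs
    obtain ⟨t, rfl⟩ := Submodule.mem_span_singleton.1 ht
    have e1 := h.prop a' ha' b' hb'
    have e2 := hx b' hb'
    have e3 : l ⁅a', x⁆ = 0 := by rw [apply_lie_eq_neg, hx a' ha', neg_zero]
    simp [e1, e2, e3]
  exact h.le_of_ge h1 le_sup_left
    (Submodule.mem_sup_right (Submodule.mem_span_singleton_self x))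

/-- The radical of the form `l ⁅x, y⁆`. -/
def radical (l : Module.Dual K L) : Submodule K L := LinearMap.ker (bracketForm l)

theorem mem_radical {l : Module.Dual K L} {x : L} : x ∈ radical l ↔ ∀ y, l ⁅x, y⁆ = 0 := by
  rw [radical, LinearMap.mem_ker, LinearMap.ext_iff]
  rfl

theorem IsPolarization.radical_le {l : Module.Dual K L} {q : LieSubalgebra K L}
    (h : IsPolarization l q) : radical l ≤ q.toSubmodule := fun _ hx =>
  h.mem_of_forall fun y _ => mem_radical.1 hx y

/-- Maximality makes `q` equal to its own orthogonal, so `2 dim q = dim L + dim rad l`. -/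
theorem IsPolarization.card_mul_card [Finite K] [FiniteDimensional K L] {l : Module.Dual K L}
    {q : LieSubalgebra K L} (h : IsPolarization l q) :
    Nat.card q * Nat.card q = Nat.card L * Nat.card (radical l) := by
  have hrefl := (bracketForm_isAlt l).isRefl
  have h1 := LinearMap.BilinForm.finrank_add_finrank_orthogonal hrefl q.toSubmodule
  have h2 : (bracketForm l).orthogonal q.toSubmodule = q.toSubmodule := by
    ext x
    rw [LinearMap.BilinForm.mem_orthogonal_iff]
    refine ⟨fun hx => h.mem_of_forall fun y hy => ?_, fun hx y hy => h.prop y hy x hx⟩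
    rw [apply_lie_eq_neg, neg_eq_zero]
    exact hx y hy
  have h3 : (bracketForm l).orthogonal ⊤ = radical l :=
    LinearMap.BilinForm.orthogonal_top_eq_ker hrefl
  rw [h2, h3, inf_eq_right.2 h.radical_le] at h1
  have h4 : Nat.card q = Nat.card q.toSubmodule := rfl
  rw [h4, Module.natCard_eq_pow_finrank (K := K) (V := q.toSubmodule),
    Module.natCard_eq_pow_finrank (K := K) (V := L),
    Module.natCard_eq_pow_finrank (K := K) (V := radical l), ← pow_add, ← pow_add, h1]

end Polarization

/-! ### Induced characters, Frobenius reciprocity and multiplicities -/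

section Representations

open Representation

variable {G : Type*} [Group G]

/-- The trace of an endomorphism induced on coinvariants. -/
theorem card_mul_trace_coinvariants_map {H V : Type*} [Group H] [Fintype H] [AddCommGroup V]
    [Module ℂ V] [FiniteDimensional ℂ V] (ρ : Representation ℂ H V)
    (f : IntertwiningMap ρ ρ) :
    (Fintype.card H : ℂ) * LinearMap.trace ℂ _ (Coinvariants.map ρ ρ f) =
      ∑ h : H, LinearMap.trace ℂ V (f.toLinearMap ∘ₗ ρ h) := by
  have hcard : (Fintype.card H : ℂ) ≠ 0 := Nat.cast_ne_zero.2 Fintype.card_ne_zero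
  -- The norm `∑ ρ h` factors through coinvariants, and following it by the projection is
  -- multiplication by `|H|`. Cyclicity of the trace then moves the computation to `V`.
  let s : Coinvariants ρ →ₗ[ℂ] V := Coinvariants.lift ρ (∑ h : H, ρ h) (by
    intro x
    ext v
    simp only [LinearMap.comp_apply, LinearMap.sum_apply, ← Module.End.mul_apply, ← map_mul]
    exact Fintype.sum_equiv (Equiv.mulRight x) _ _ (by simp))
  have hs1 : s ∘ₗ Coinvariants.mk ρ = ∑ h : H, ρ h := Coinvariants.lift_comp_mk _ _ _
  have hs2 : Coinvariants.mk ρ ∘ₗ s = (Fintype.card H : ℂ) • LinearMap.id := by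
    apply Coinvariants.hom_ext
    rw [LinearMap.comp_assoc, hs1]
    ext v
    simp [Coinvariants.mk_self_apply, Finset.card_univ]
    exact (Nat.cast_smul_eq_nsmul ℂ _ _).symm
  have h1 : Coinvariants.map ρ ρ f ∘ₗ Coinvariants.mk ρ ∘ₗ s =
      (Fintype.card H : ℂ) • Coinvariants.map ρ ρ f := by
    rw [hs2, LinearMap.comp_smul, LinearMap.comp_id]
  rw [← smul_eq_mul, ← map_smul, ← h1, ← LinearMap.comp_assoc, Coinvariants.map_comp_mk,
    LinearMap.comp_assoc, LinearMap.trace_comp_comm', LinearMap.comp_assoc, hs1]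
  change LinearMap.trace ℂ V (f.toLinearMap ∘ₗ ∑ h : H, ρ h) = _
  rw [show f.toLinearMap ∘ₗ ∑ h : H, ρ h = ∑ h : H, f.toLinearMap ∘ₗ ρ h by
    ext v; simp [LinearMap.sum_apply]]
  exact map_sum _ _ _

theorem trace_mapDomainLinearMap {X : Type*} [Fintype X] [DecidableEq X] (σ : X → X) :
    LinearMap.trace ℂ _ (MonoidAlgebra.mapDomainLinearMap ℂ ℂ σ) =
      ∑ x : X, if σ x = x then (1 : ℂ) else 0 := by
  let b : Module.Basis X ℂ (MonoidAlgebra ℂ X) := ⟨MonoidAlgebra.coeffLinearEquiv ℂ⟩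
  rw [LinearMap.trace_eq_matrix_trace ℂ b, Matrix.trace]
  refine Finset.sum_congr rfl fun x _ => ?_
  have hb : b x = MonoidAlgebra.single x 1 := by
    apply b.repr.injective
    rw [b.repr_self]
    rfl
  rw [Matrix.diag_apply, LinearMap.toMatrix_apply, hb]
  have : MonoidAlgebra.mapDomainLinearMap ℂ ℂ σ (MonoidAlgebra.single x 1) =
      MonoidAlgebra.single (σ x) 1 := by simp
  rw [this]
  change (Finsupp.single (σ x) (1 : ℂ)) x = _
  rw [Finsupp.single_apply]

/-- The character of an induced representation. -/
theorem card_mul_char_ind {H W : Type*} [Group H] [Fintype H] [Fintype G] [DecidableEq G]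
    [AddCommGroup W] [Module ℂ W] [FiniteDimensional ℂ W] (φ : H →* G)
    (ρ : Representation ℂ H W) (g : G) :
    (Fintype.card H : ℂ) * (ind φ ρ).character g =
      ∑ h : H, ∑ x : G, if φ h * x = x * g then ρ.character h else 0 := by
  have : Module.Finite ℂ (MonoidAlgebra ℂ G) :=
    Module.Finite.equiv (MonoidAlgebra.coeffLinearEquiv ℂ).symm
  rw [character, ind_apply, card_mul_trace_coinvariants_map]
  refine Finset.sum_congr rfl fun h _ => ?_
  have h1 : (MonoidAlgebra.mapDomainLinearMap ℂ ℂ fun x : G => x * g⁻¹).rTensor W ∘ₗ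
      (tprod ((leftRegular ℂ G).comp φ) ρ) h =
      TensorProduct.map (MonoidAlgebra.mapDomainLinearMap ℂ ℂ fun x : G => φ h * x * g⁻¹)
        (ρ h) := by
    ext x w
    simp
  have h2 : LinearMap.trace ℂ (TensorProduct ℂ (MonoidAlgebra ℂ G) W)
      ((MonoidAlgebra.mapDomainLinearMap ℂ ℂ fun x : G => x * g⁻¹).rTensor W ∘ₗ
      (tprod ((leftRegular ℂ G).comp φ) ρ) h) =
      ∑ x : G, if φ h * x = x * g then ρ.character h else 0 := by
    rw [h1, LinearMap.trace_tensorProduct', trace_mapDomainLinearMap, Finset.sum_mul]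
    refine Finset.sum_congr rfl fun x _ => ?_
    simp only [mul_inv_eq_iff_eq_mul, ite_mul, one_mul, zero_mul]
    rfl
  exact h2

/-- Frobenius reciprocity by characters. With `ρ` as the source on the right, the dimensions agree
because the character sums match after `h ↦ h⁻¹`. -/
theorem finrank_intertwiningMap_ind {H V W : Type*} [Group H] [Finite H] [Finite G]
    [AddCommGroup W] [Module ℂ W] [FiniteDimensional ℂ W]
    [AddCommGroup V] [Module ℂ V] [FiniteDimensional ℂ V] (φ : H →* G)
    (ρ : Representation ℂ H W) (T : Representation ℂ G V) :
    Module.finrank ℂ (IntertwiningMap T (ind φ ρ)) =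
      Module.finrank ℂ (IntertwiningMap ρ (T.comp φ)) := by
  classical
  have := Fintype.ofFinite G
  have := Fintype.ofFinite H
  have hG : (Nat.card G : ℂ) ≠ 0 := Nat.cast_ne_zero.2 Nat.card_pos.ne'
  have hH : (Nat.card H : ℂ) ≠ 0 := Nat.cast_ne_zero.2 Nat.card_pos.ne'
  have := invertibleOfNonzero hG
  have := invertibleOfNonzero hH
  have : Module.Finite ℂ (MonoidAlgebra ℂ G) :=
    Module.Finite.equiv (MonoidAlgebra.coeffLinearEquiv ℂ).symm
  rw [← Nat.cast_inj (R := ℂ), ← card_inv_mul_sum_char_mul_char_eq_finrank,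
    ← card_inv_mul_sum_char_mul_char_eq_finrank]
  have h1 : (Nat.card H : ℂ) * ∑ g : G, (ind φ ρ).character g * T.character g⁻¹ =
      (Nat.card G : ℂ) * ∑ h : H, character (T.comp φ) h * ρ.character h⁻¹ := by
    have h2 : ∀ g : G, (Nat.card H : ℂ) * ((ind φ ρ).character g * T.character g⁻¹) =
        ∑ h : H, ∑ x : G, if x⁻¹ * φ h * x = g then ρ.character h * T.character g⁻¹ else 0 := by
      intro g
      rw [← mul_assoc, Nat.card_eq_fintype_card, card_mul_char_ind, Finset.sum_mul]
      refine Finset.sum_congr rfl fun h _ => ?_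
      rw [Finset.sum_mul]
      refine Finset.sum_congr rfl fun x _ => ?_
      simp only [mul_assoc, inv_mul_eq_iff_eq_mul, ite_mul, zero_mul]
    rw [Finset.mul_sum, Finset.sum_congr rfl fun g _ => h2 g, Finset.sum_comm, Finset.mul_sum]
    refine Fintype.sum_equiv (Equiv.inv H) _ _ fun h => ?_
    rw [Finset.sum_comm]
    simp only [Finset.sum_ite_eq, Finset.mem_univ, if_true]
    have h3 : ∀ x : G, T.character (x⁻¹ * φ h * x)⁻¹ = T.character (φ h)⁻¹ := by
      intro x
      rw [show (x⁻¹ * φ h * x)⁻¹ = x⁻¹ * (φ h)⁻¹ * x⁻¹⁻¹ by group, char_conj]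
    simp only [h3, Finset.sum_const, Finset.card_univ, nsmul_eq_mul, Equiv.inv_apply, inv_inv,
      ← Nat.card_eq_fintype_card]
    rw [mul_comm (ρ.character h), ← map_inv]
    rfl
  field_simp
  linear_combination h1

/-- By Maschke a subrepresentation has an equivariant projection. It is a scalar `c`, so the
subrepresentation is zero if `c = 0` and everything otherwise. -/
theorem isIrreducible_of_finrank_eq_one [Finite G] {V : Type*} [AddCommGroup V] [Module ℂ V]
    (T : Representation ℂ G V) (h : Module.finrank ℂ (IntertwiningMap T T) = 1) :
    T.IsIrreducible := by
  have : NeZero (Nat.card G : ℂ) := ⟨Nat.cast_ne_zero.2 Nat.card_pos.ne'⟩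
  have hV : Nontrivial V := by
    by_contra hV
    rw [not_nontrivial_iff_subsingleton] at hV
    have : Subsingleton (IntertwiningMap T T) :=
      ⟨fun a b => IntertwiningMap.ext (LinearMap.ext fun v => Subsingleton.elim _ _)⟩
    rw [Module.finrank_zero_of_subsingleton] at h
    exact zero_ne_one h
  have hone : (1 : IntertwiningMap T T) ≠ 0 := by
    intro h0
    obtain ⟨v, hv⟩ := exists_ne (0 : V)
    exact hv (congrArg (fun f : IntertwiningMap T T => f v) h0)
  have hsc := (finrank_eq_one_iff_of_nonzero' _ hone).1 h
  rw [irreducible_iff_isSimpleModule_asModule, isSimpleModule_iff]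
  have hnt : Nontrivial T.asModule := hV
  refine { toNontrivial := inferInstance, eq_bot_or_eq_top := fun N => ?_ }
  obtain ⟨r, hr⟩ := MonoidAlgebra.exists_leftInverse_of_injective N.subtype N.ker_subtype
  obtain ⟨c, hc⟩ := hsc ((IntertwiningMap.equivLinearMapAsModule T T).symm (N.subtype ∘ₗ r))
  have hc' : ∀ v : T.asModule, c • v = (r v : T.asModule) := fun v =>
    congrArg (fun f : IntertwiningMap T T => f v) hc
  by_cases hc0 : c = 0
  · left
    rw [eq_bot_iff]
    intro v hv
    have h1 := hc' v
    rw [hc0, zero_smul, show r v = ⟨v, hv⟩ from LinearMap.congr_fun hr ⟨v, hv⟩] at h1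
    exact h1.symm
  · right
    rw [eq_top_iff]
    intro v _
    have h1 := hc' (c⁻¹ • v)
    rw [smul_smul, mul_inv_cancel₀ hc0, one_smul] at h1
    rw [h1]
    exact (r _).2

/-- Induction on `s`. The vectors that `f a` sends into the sum of the other images form a
subrepresentation `N`. If `N` is everything, the unique coordinates are endomorphisms of `T`, hence
scalars by Schur, contradicting independence. -/
theorem finsuppMap_injective {V W : Type*} [AddCommGroup V] [Module ℂ V]
    [FiniteDimensional ℂ V] [AddCommGroup W] [Module ℂ W] {T : Representation ℂ G V}
    {R : Representation ℂ G W} (hT : T.IsIrreducible) {ι : Type*}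
    (f : ι → IntertwiningMap T R) (hf : LinearIndependent ℂ f) (s : Finset ι) :
    ∀ x : ι → V, ∑ i ∈ s, f i (x i) = 0 → ∀ i ∈ s, x i = 0 := by
  classical
  induction s using Finset.induction_on with
  | empty => simp
  | insert a s ha ih =>
    let N : Subrepresentation T :=
      { toSubmodule :=
          { carrier := {v | ∃ x : ι → V, f a v = ∑ i ∈ s, f i (x i)}
            add_mem' := by
              rintro u v ⟨x, hx⟩ ⟨y, hy⟩
              exact ⟨x + y, by simp [hx, hy, Finset.sum_add_distrib]⟩
            zero_mem' := ⟨0, by simp⟩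
            smul_mem' := by
              rintro c v ⟨x, hx⟩
              exact ⟨c • x, by simp [hx, Finset.smul_sum]⟩ }
        apply_mem_toSubmodule := by
          rintro g v ⟨x, hx⟩
          exact ⟨fun i => T g (x i), by
            simp [IntertwiningMap.isIntertwining, hx]⟩ }
    have hmem : ∀ v, v ∈ N ↔ ∃ x : ι → V, f a v = ∑ i ∈ s, f i (x i) := fun v => Iff.rfl
    have huniq : ∀ x y : ι → V, ∑ i ∈ s, f i (x i) = ∑ i ∈ s, f i (y i) →
        ∀ i ∈ s, x i = y i := by
      intro x y hxy i hi
      rw [← sub_eq_zero]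
      refine ih (x - y) ?_ i hi
      simp [hxy]
    rcases eq_bot_or_eq_top N with hN | hN
    · intro x hx
      rw [Finset.sum_insert ha] at hx
      have h1 : x a ∈ N := (hmem _).2 ⟨-x, by
        simp only [Pi.neg_apply, map_neg, Finset.sum_neg_distrib]
        exact eq_neg_of_add_eq_zero_left hx⟩
      rw [hN] at h1
      have h2 : x a = 0 := h1
      rw [h2, map_zero, zero_add] at hx
      intro i hi
      rcases Finset.mem_insert.1 hi with rfl | hi
      · exact h2
      · exact ih x hx i hi
    · exfalso
      have hall : ∀ v, ∃ x : ι → V, f a v = ∑ i ∈ s, f i (x i) := fun v => by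
        rw [← hmem, hN]
        trivial
      choose x hx using hall
      let e : s → IntertwiningMap T T := fun i =>
        { toFun := fun v => x v i
          map_add' := fun u v => huniq (x (u + v)) (x u + x v) (by
            rw [← hx, map_add, hx, hx]
            simp [Finset.sum_add_distrib]) i i.2
          map_smul' := fun c v => huniq (x (c • v)) (c • x v) (by
            rw [← hx, map_smul, hx]
            simp [Finset.smul_sum]) i i.2
          isIntertwining' := fun g => LinearMap.ext fun v =>
            huniq (x (T g v)) (fun i => T g (x v i)) (by
              rw [← hx, IntertwiningMap.isIntertwining, hx]
              simp [IntertwiningMap.isIntertwining]) i i.2 }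
      have hsc : ∀ i : s, ∃ c : ℂ, e i = c • 1 := fun i => by
        obtain ⟨c, hc⟩ :=
          (IsIrreducible.algebraMap_intertwiningMap_bijective_of_isAlgClosed (ρ := T)).2 (e i)
        exact ⟨c, hc.symm⟩
      choose c hc using hsc
      have h1 : f a = ∑ i : s, c i • f i := by
        apply IntertwiningMap.ext
        ext v
        rw [IntertwiningMap.toLinearMap_apply, hx, IntertwiningMap.toLinearMap_apply,
          IntertwiningMap.sum_apply, ← Finset.sum_coe_sort]
        refine Finset.sum_congr rfl fun i _ => ?_
        have h2 : x v i = c i • v := congrArg (fun f : IntertwiningMap T T => f v) (hc i)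
        rw [h2, map_smul]
        rfl
      refine (linearIndepOn_insert ha).1 (hf.linearIndepOn (s := insert a (s : Set ι))) |>.2 ?_
      rw [h1]
      exact Submodule.sum_mem _ fun i _ => Submodule.smul_mem _ _
        (Submodule.subset_span ⟨i, i.2, rfl⟩)

/-- A basis of the intertwining space embeds that many copies of `T`; conversely, the components of
an embedding are linearly independent. -/
theorem mult_eq_finrank {V W : Type*} [AddCommGroup V] [Module ℂ V]
    [FiniteDimensional ℂ V] [AddCommGroup W] [Module ℂ W] [FiniteDimensional ℂ W]
    {T : Representation ℂ G V} (R : Representation ℂ G W) (hT : T.IsIrreducible) :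
    mult T R = Module.finrank ℂ (IntertwiningMap T R) := by
  refine IsGreatest.csSup_eq ⟨?_, ?_⟩
  · let b := Module.finBasis ℂ (IntertwiningMap T R)
    let F : (Fin (Module.finrank ℂ (IntertwiningMap T R)) →₀ V) →ₗ[ℂ] W :=
      Finsupp.lsum ℂ fun i => (b i).toLinearMap
    have hF : ∀ x, F x = ∑ i, b i (x i) := fun x => by
      simp only [F, Finsupp.coe_lsum]
      rw [Finsupp.sum_fintype _ _ (by simp)]
      rfl
    refine ⟨{ F with isIntertwining' := fun g => ?_ }, ?_⟩
    · refine Finsupp.lhom_ext fun i v => ?_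
      simp [F, IntertwiningMap.isIntertwining]
    · refine (injective_iff_map_eq_zero F).2 fun x hx => ?_
      ext i
      exact finsuppMap_injective hT b b.linearIndependent Finset.univ x
        (by rw [← hF, hx]) i (Finset.mem_univ i)
  · rintro m ⟨f, hf⟩
    let c : Fin m → IntertwiningMap T R := fun i =>
      { toLinearMap := f.toLinearMap ∘ₗ Finsupp.lsingle i
        isIntertwining' := fun g => by
          ext v
          have := LinearMap.congr_fun (f.isIntertwining' g) (Finsupp.single i v)
          simpa using this }
    have hc : LinearIndependent ℂ c := by
      obtain ⟨v, hv⟩ : ∃ v : V, v ≠ 0 := by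
        by_contra! h
        refine bot_ne_top (α := Subrepresentation T) ?_
        refine SetLike.ext fun v => ?_
        rw [h v]
        exact ⟨fun _ => trivial, fun _ => (⊥ : Subrepresentation T).toSubmodule.zero_mem⟩
      rw [Fintype.linearIndependent_iff]
      intro d hd i
      have h1 : f (∑ i, Finsupp.single i (d i • v)) = 0 := by
        have h2 : (∑ i, d i • c i) v = 0 := by rw [hd]; rfl
        rw [IntertwiningMap.sum_apply] at h2
        rw [map_sum, ← h2]
        refine Finset.sum_congr rfl fun j _ => ?_
        rw [← Finsupp.smul_single, map_smul]
        rfl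
      have h3 : ∑ i, Finsupp.single i (d i • v) = 0 := hf (h1.trans (map_zero f).symm)
      have h4 := DFunLike.congr_fun h3 i
      rw [Finsupp.finsetSum_apply] at h4
      simp only [Finsupp.single_apply] at h4
      simpa [hv] using h4
    simpa using hc.fintype_card_le_finrank

end Representations

/-! ### The group `exp g` and its coadjoint action -/

section ExpGroup

variable {K : Type*} [Field K] {N : ℕ}

theorem pow_eq_bot_of_prod_eq_zero {A : Type*} [Ring A] [Algebra K A] {W : Submodule K A} {p : ℕ}
    (h : ∀ s : List A, (∀ x ∈ s, x ∈ W) → s.length = p → s.prod = 0) : W ^ p = ⊥ := by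
  rw [Submodule.pow_eq_span_pow_set, Submodule.span_eq_bot]
  intro x hx
  obtain ⟨f, rfl⟩ := Set.mem_pow.1 hx
  refine h _ (fun x hx => ?_) (by simp)
  obtain ⟨i, rfl⟩ := (List.mem_ofFn' _ _).1 hx
  exact (f i).2

theorem matExp_eq_truncExp (p : ℕ) (x : Matrix (Fin N) (Fin N) K) :
    matExp p x = truncExp K p x := rfl

theorem conj_eq_sum {p : ℕ} [CharP K p] [Fact p.Prime]
    {g : LieSubalgebra K (Matrix (Fin N) (Fin N) K)} (hW : g.toSubmodule ^ p = ⊥) (x y : g) :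
    matExp p (x : Matrix (Fin N) (Fin N) K) * y * matExp p ((-x : g) : Matrix (Fin N) (Fin N) K) =
      ((∑ k ∈ Finset.range p, (k.factorial : K)⁻¹ • ((LieAlgebra.ad K g x) ^ k) y : g) :
        Matrix (Fin N) (Fin N) K) := by
  rw [matExp_eq_truncExp, matExp_eq_truncExp, NegMemClass.coe_neg, truncExp_conj_eq_sum p hW x.2 y.2]
  have : ∀ k, ((LieAlgebra.ad K (Matrix (Fin N) (Fin N) K) x) ^ k) y =
      (((LieAlgebra.ad K g x) ^ k) y : g) := fun k => (LieSubalgebra.coe_ad_pow K _ g x y k).symm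
  simp [this]

variable [Finite K] {p : ℕ} [CharP K p] [Fact p.Prime]
  {g : LieSubalgebra K (Matrix (Fin N) (Fin N) K)}

theorem mem_expGroup (hW : g.toSubmodule ^ p = ⊥) {u : GL (Fin N) K} :
    u ∈ expGroup p g ↔ ∃ x ∈ g, (u : Matrix (Fin N) (Fin N) K) = matExp p x := by
  refine ⟨fun hu => ?_, fun hu => Subgroup.subset_closure hu⟩
  induction hu using Subgroup.closure_induction with
  | mem u hu => exact hu
  | one => exact ⟨0, g.zero_mem, (truncExp_zero p).symm⟩
  | mul u v _ _ hu hv =>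
    obtain ⟨x, hx, hu⟩ := hu
    obtain ⟨y, hy, hv⟩ := hv
    obtain ⟨z, hz, h⟩ := expClosed p g.toSubmodule hW (fun a ha b hb => g.lie_mem ha hb) x hx y hy
    exact ⟨z, hz, by rw [Units.val_mul, hu, hv]; exact h⟩
  | inv u _ hu =>
    obtain ⟨x, hx, hu⟩ := hu
    refine ⟨-x, neg_mem hx, ?_⟩
    refine Units.inv_eq_of_mul_eq_one_right ?_
    rw [hu]
    exact truncExp_mul_truncExp_neg p (pow_eq_zero_of_mem hW hx)

/-- The exponential map as a bijection of `g` onto `expGroup p g`. -/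
def expEquiv (hW : g.toSubmodule ^ p = ⊥) : g ≃ expGroup p g :=
  Equiv.ofBijective
    (fun x => ⟨⟨matExp p x, matExp p (-x),
      truncExp_mul_truncExp_neg p (pow_eq_zero_of_mem hW x.2),
      truncExp_neg_mul_truncExp p (pow_eq_zero_of_mem hW x.2)⟩,
      (mem_expGroup hW).2 ⟨x, x.2, rfl⟩⟩)
    ⟨fun x y hxy => Subtype.ext (truncExp_injOn p hW x.2 y.2
        (congrArg (fun u : expGroup p g => ((u : GL (Fin N) K) : Matrix (Fin N) (Fin N) K)) hxy)),
      fun u => by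
        obtain ⟨x, hx, h⟩ := (mem_expGroup hW).1 u.2
        exact ⟨⟨x, hx⟩, Subtype.ext (Units.ext h.symm)⟩⟩

theorem coe_expEquiv (hW : g.toSubmodule ^ p = ⊥) (x : g) :
    ((expEquiv hW x : GL (Fin N) K) : Matrix (Fin N) (Fin N) K) = matExp p x := rfl

theorem coe_expEquiv_inv (hW : g.toSubmodule ^ p = ⊥) (x : g) :
    (((expEquiv hW x)⁻¹ : expGroup p g) : GL (Fin N) K).val = matExp p (-x) := rfl

theorem expEquiv_neg (hW : g.toSubmodule ^ p = ⊥) (x : g) :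
    expEquiv hW (-x) = (expEquiv hW x)⁻¹ := by
  apply Subtype.ext
  apply Units.ext
  rw [coe_expEquiv_inv, coe_expEquiv]

theorem bijOn_matExp (hW : g.toSubmodule ^ p = ⊥) :
    Set.BijOn (matExp p) (g : Set (Matrix (Fin N) (Fin N) K))
      ((fun u : GL (Fin N) K => (u : Matrix (Fin N) (Fin N) K)) ''
        (expGroup p g : Set (GL (Fin N) K))) := by
  refine ⟨fun x hx => ⟨_, (expEquiv hW ⟨x, hx⟩).2, rfl⟩, truncExp_injOn p hW, ?_⟩
  rintro _ ⟨u, hu, rfl⟩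
  obtain ⟨x, hx, h⟩ := (mem_expGroup hW).1 hu
  exact ⟨x, hx, h.symm⟩

/-- The adjoint action of `exp g` on `g`. -/
def adjoint (hW : g.toSubmodule ^ p = ⊥) (u : expGroup p g) : g →ₗ[K] g where
  toFun y := ⟨(u : GL (Fin N) K).val * y * ((u⁻¹ : expGroup p g) : GL (Fin N) K).val, by
    obtain ⟨x, rfl⟩ := (expEquiv hW).surjective u
    rw [coe_expEquiv, coe_expEquiv_inv, conj_eq_sum hW]
    exact Subtype.property _⟩
  map_add' y z := Subtype.ext (by simp [mul_add, add_mul])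
  map_smul' c y := Subtype.ext (by simp)

theorem coe_adjoint (hW : g.toSubmodule ^ p = ⊥) (u : expGroup p g) (y : g) :
    (adjoint hW u y : Matrix (Fin N) (Fin N) K) =
      (u : GL (Fin N) K).val * y * ((u⁻¹ : expGroup p g) : GL (Fin N) K).val := rfl

theorem adjoint_one (hW : g.toSubmodule ^ p = ⊥) (y : g) : adjoint hW 1 y = y :=
  Subtype.ext (by simp [coe_adjoint])

theorem adjoint_mul (hW : g.toSubmodule ^ p = ⊥) (u v : expGroup p g) (y : g) :
    adjoint hW (u * v) y = adjoint hW u (adjoint hW v y) :=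
  Subtype.ext (by simp [coe_adjoint, mul_assoc])

theorem adjoint_expEquiv (hW : g.toSubmodule ^ p = ⊥) (x y : g) :
    adjoint hW (expEquiv hW x) y =
      ∑ k ∈ Finset.range p, (k.factorial : K)⁻¹ • ((LieAlgebra.ad K g x) ^ k) y :=
  Subtype.ext (conj_eq_sum hW x y)

theorem conj_expEquiv (hW : g.toSubmodule ^ p = ⊥) (u : expGroup p g) (y : g) :
    u * expEquiv hW y * u⁻¹ = expEquiv hW (adjoint hW u y) := by
  apply Subtype.ext
  apply Units.ext
  have := truncExp_conj (K := K) p (u := (u : GL (Fin N) K).val)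
    (v := ((u⁻¹ : expGroup p g) : GL (Fin N) K).val) (by simp) (by simp) y
  exact this.symm

/-- The coadjoint action of `exp g`. -/
abbrev coadjointAction (hW : g.toSubmodule ^ p = ⊥) :
    MulAction (expGroup p g) (Module.Dual K g) where
  smul u l := l ∘ₗ adjoint hW u⁻¹
  one_smul l := LinearMap.ext fun y => by
    change l (adjoint hW 1⁻¹ y) = l y
    rw [inv_one, adjoint_one]
  mul_smul u v l := LinearMap.ext fun y => by
    change l (adjoint hW (u * v)⁻¹ y) = l (adjoint hW v⁻¹ (adjoint hW u⁻¹ y))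
    rw [mul_inv_rev, adjoint_mul]

theorem coadjointOrbit_eq_orbit (hW : g.toSubmodule ^ p = ⊥) (l : Module.Dual K g) :
    coadjointOrbit p g l =
      @MulAction.orbit (expGroup p g) _ (coadjointAction hW).toSMul l := by
  let := coadjointAction hW
  ext m
  rw [MulAction.mem_orbit_iff]
  constructor
  · rintro ⟨u, hu, h⟩
    refine ⟨⟨u, hu⟩, LinearMap.ext fun x => ?_⟩
    obtain ⟨y, hy, hm⟩ := h x
    rw [hm]
    exact congrArg l (Subtype.ext (by rw [hy, coe_adjoint, inv_inv]; rfl))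
  · rintro ⟨u, rfl⟩
    refine ⟨u, u.2, fun x => ⟨adjoint hW u⁻¹ x, ?_, rfl⟩⟩
    rw [coe_adjoint, inv_inv]
    rfl

theorem comp_adjoint_expEquiv_apply (hW : g.toSubmodule ^ p = ⊥) (l : Module.Dual K g)
    (x y : g) :
    (l ∘ₗ adjoint hW (expEquiv hW x)) y =
      ∑ k ∈ Finset.range p, (k.factorial : K)⁻¹ • l (((LieAlgebra.ad K g x) ^ k) y) := by
  rw [LinearMap.comp_apply, adjoint_expEquiv]
  simp

theorem sum_range_eq_zero_term {M : Type*} [AddCommMonoid M] (f : ℕ → M) {n : ℕ} (hn : 0 < n)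
    (hf : ∀ k, f (k + 1) = 0) : ∑ k ∈ Finset.range n, f k = f 0 := by
  rw [Finset.sum_eq_single 0]
  · rintro (_ | k) _ hk
    · exact absurd rfl hk
    · exact hf k
  · intro h
    exact absurd (Finset.mem_range.2 hn) h

/-- The coadjoint stabilizer of `l` is `exp (rad l)`: if the exponential of the transpose of `ad x`,
which is nilpotent, fixes `l`, then that transpose kills `l`. -/
theorem comp_adjoint_expEquiv_eq_self_iff (hW : g.toSubmodule ^ p = ⊥) (l : Module.Dual K g)
    (x : g) : l ∘ₗ adjoint hW (expEquiv hW x) = l ↔ x ∈ radical l := by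
  rw [mem_radical]
  constructor
  · intro h y
    let D : Module.End K (Module.Dual K g) := Module.Dual.transpose (LieAlgebra.ad K g x)
    have hD : ∀ k, (D ^ k) l = l ∘ₗ (LieAlgebra.ad K g x) ^ k := by
      intro k
      induction k with
      | zero => rfl
      | succ k ih =>
        rw [pow_succ', Module.End.mul_apply, ih, pow_succ]
        rfl
    have hp0 : (LieAlgebra.ad K g x) ^ p = 0 := LinearMap.ext fun y => Subtype.ext (by
      rw [LieSubalgebra.coe_ad_pow]
      exact ad_pow_eq_zero hW x.2 y.2)
    have h1 := apply_eq_zero_of_sum_pow_apply_eq p D l p (by rw [hD, hp0, LinearMap.comp_zero]) (by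
      refine LinearMap.ext fun y => ?_
      have h2 := LinearMap.congr_fun h y
      rw [comp_adjoint_expEquiv_apply] at h2
      rw [← h2]
      simp [hD])
    exact LinearMap.congr_fun h1 y
  · intro h
    refine LinearMap.ext fun y => ?_
    rw [comp_adjoint_expEquiv_apply, sum_range_eq_zero_term _ (Fact.out : p.Prime).pos]
    · simp
    · intro k
      rw [pow_succ', Module.End.mul_apply, LieAlgebra.ad_apply, h, smul_zero]

theorem comp_adjoint_expEquiv_apply_of_mem (hW : g.toSubmodule ^ p = ⊥) {l : Module.Dual K g}
    {q : LieSubalgebra K g} (hq : IsIsotropic l q.toSubmodule) {x y : g} (hx : x ∈ q)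
    (hy : y ∈ q) : l (adjoint hW (expEquiv hW x) y) = l y := by
  have := comp_adjoint_expEquiv_apply hW l x y
  rw [LinearMap.comp_apply] at this
  rw [this, sum_range_eq_zero_term _ (Fact.out : p.Prime).pos]
  · simp
  · intro k
    have hmem : ((LieAlgebra.ad K g x) ^ k) y ∈ q := by
      induction k with
      | zero => simpa using hy
      | succ k ih =>
        rw [pow_succ', Module.End.mul_apply, LieAlgebra.ad_apply]
        exact q.lie_mem hx ih
    rw [pow_succ', Module.End.mul_apply, LieAlgebra.ad_apply, hq x hx _ hmem, smul_zero]

theorem card_expGroup (hW : g.toSubmodule ^ p = ⊥) : Nat.card (expGroup p g) = Nat.card g :=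
  (Nat.card_congr (expEquiv hW)).symm

theorem card_stabilizer (hW : g.toSubmodule ^ p = ⊥) (l : Module.Dual K g) :
    Nat.card (@MulAction.stabilizer (expGroup p g) _ _ (coadjointAction hW) l) =
      Nat.card (radical l) := by
  let := coadjointAction hW
  refine (Nat.card_congr (Equiv.subtypeEquiv (expEquiv hW) fun x => ?_)).symm
  rw [MulAction.mem_stabilizer_iff, ← neg_mem_iff, ← comp_adjoint_expEquiv_eq_self_iff hW,
    expEquiv_neg]
  rfl

end ExpGroup

/-! ### Orbit sums and the character formula -/

theorem sum_smul_eq_card_stabilizer_mul {G X : Type*} [Group G] [Fintype G] [MulAction G X]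
    (x : X) (s : Finset X) (hs : ∀ y, y ∈ s ↔ y ∈ MulAction.orbit G x) (F : X → ℂ) :
    ∑ g : G, F (g • x) = (Nat.card (MulAction.stabilizer G x) : ℂ) * ∑ y ∈ s, F y := by
  classical
  rw [← Finset.sum_fiberwise_of_maps_to (s := Finset.univ) (t := s) (g := fun g : G => g • x)
    (fun g _ => (hs _).2 ⟨g, rfl⟩), Finset.mul_sum]
  refine Finset.sum_congr rfl fun y hy => ?_
  obtain ⟨a, rfl⟩ := (hs y).1 hy
  rw [Finset.sum_congr rfl (g := fun _ => F (a • x)) (fun g hg => by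
    rw [(Finset.mem_filter.1 hg).2]), Finset.sum_const, nsmul_eq_mul]
  congr 2
  rw [← Fintype.card_subtype, ← Nat.card_eq_fintype_card]
  refine Nat.card_congr (Equiv.subtypeEquiv (Equiv.mulLeft a⁻¹) fun g => ?_)
  rw [MulAction.mem_stabilizer_iff, Equiv.coe_mulLeft, mul_smul, inv_smul_eq_iff]

theorem exists_apply_ne_one {K : Type*} [Field K] {ψ : AddChar K ℂ} (hψ : ψ ≠ 1) {c : K}
    (hc : c ≠ 0) : ∃ a : K, ψ (a * c) ≠ 1 := by
  obtain ⟨b, hb⟩ := AddChar.ne_one_iff.1 hψ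
  exact ⟨b / c, by rwa [div_mul_cancel₀ _ hc]⟩

section OrbitCharacter

variable {K : Type*} [Field K] {N : ℕ} {p : ℕ} {g : LieSubalgebra K (Matrix (Fin N) (Fin N) K)}

theorem map_incl_pow_eq_bot (hW : g.toSubmodule ^ p = ⊥) (q : LieSubalgebra K g) :
    (q.map g.incl).toSubmodule ^ p = ⊥ :=
  pow_eq_bot_mono (map_incl_le q) hW

theorem card_dualAnnihilator_mul_card (q : LieSubalgebra K g) :
    Nat.card q.toSubmodule.dualAnnihilator * Nat.card q = Nat.card g := by
  have h4 : Nat.card q = Nat.card q.toSubmodule := rfl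
  rw [h4, Module.natCard_eq_pow_finrank (K := K) (V := q.toSubmodule),
    Module.natCard_eq_pow_finrank (K := K) (V := q.toSubmodule.dualAnnihilator),
    ← pow_add, add_comm, Subspace.finrank_add_finrank_dualAnnihilator_eq,
    ← Module.natCard_eq_pow_finrank]

/-- If `y ∉ q`, some form vanishing on `q` does not vanish at `y`; translating by a suitable
multiple rescales the sum by a factor other than `1`, so it is zero. -/
theorem sum_addChar_agree {ψ : AddChar K ℂ} (hψ : ψ ≠ 1) (l : Module.Dual K g)
    (q : LieSubalgebra K g) (y : g) [Decidable (y ∈ q)] (s : Finset (Module.Dual K g))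
    (hs : ∀ m, m ∈ s ↔ ∀ z ∈ q, m z = l z) :
    ∑ m ∈ s, ψ (m y) =
      if y ∈ q then (Nat.card q.toSubmodule.dualAnnihilator : ℂ) * ψ (l y) else 0 := by
  split_ifs with hy
  · rw [Finset.sum_congr rfl (g := fun _ => ψ (l y)) fun m hm => by rw [(hs m).1 hm y hy],
      Finset.sum_const, nsmul_eq_mul]
    congr 2
    rw [← Nat.card_eq_finsetCard]
    refine Nat.card_congr (Equiv.subtypeEquiv (Equiv.subRight l) fun m => ?_)
    simp [Submodule.mem_dualAnnihilator, sub_eq_zero, hs]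
  · obtain ⟨f, hfy, hf⟩ := Submodule.exists_le_ker_of_notMem (p := q.toSubmodule) hy
    obtain ⟨c, hc⟩ := exists_apply_ne_one hψ hfy
    have h1 : ∑ m ∈ s, ψ (m y) = ψ (c * f y) * ∑ m ∈ s, ψ (m y) := by
      rw [Finset.mul_sum]
      refine Finset.sum_equiv (Equiv.subRight (c • f)) (fun m => ?_) fun m _ => ?_
      · rw [hs, hs]
        refine forall₂_congr fun z hz => ?_
        have : f z = 0 := hf hz
        simp [this]
      · rw [← AddChar.map_add_eq_mul]
        simp
    have h2 : (1 - ψ (c * f y)) * ∑ m ∈ s, ψ (m y) = 0 := by rw [sub_mul, one_mul, ← h1, sub_self]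
    exact (mul_eq_zero.1 h2).resolve_left (sub_ne_zero.2 hc.symm)

variable [Finite K]

theorem finite_dual : Finite (Module.Dual K g) :=
  Finite.of_injective (fun l : Module.Dual K g => (l : g → K)) DFunLike.coe_injective

variable [CharP K p] [Fact p.Prime]

/-- The exponential map as a bijection of `q` onto `subExpGroup p q`. -/
def subExpEquiv (hW : g.toSubmodule ^ p = ⊥) (q : LieSubalgebra K g) : q ≃ subExpGroup p q :=
  (Equiv.ofBijective
    (fun x : q => (⟨(x : g), ⟨x, x.2, rfl⟩⟩ : q.map g.incl))
    ⟨fun x y hxy => Subtype.ext (Subtype.ext (congrArg (fun z : q.map g.incl => z.val) hxy)), by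
      rintro ⟨_, x, hx, rfl⟩
      exact ⟨⟨x, hx⟩, rfl⟩⟩).trans (expEquiv (map_incl_pow_eq_bot hW q))

theorem subExpGroupIncl_subExpEquiv (hW : g.toSubmodule ^ p = ⊥) (q : LieSubalgebra K g) (x : q) :
    subExpGroupIncl p q (subExpEquiv hW q x) = expEquiv hW (x : g) := rfl

/-- The restriction to `exp q` of the coadjoint action of `exp g`. -/
abbrev subCoadjointAction (hW : g.toSubmodule ^ p = ⊥) (q : LieSubalgebra K g) :
    MulAction (subExpGroup p q) (Module.Dual K g) :=
  letI := coadjointAction hW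
  MulAction.compHom _ (subExpGroupIncl p q)

theorem card_subExpGroup (hW : g.toSubmodule ^ p = ⊥) (q : LieSubalgebra K g) :
    Nat.card (subExpGroup p q) = Nat.card q :=
  (Nat.card_congr (subExpEquiv hW q)).symm

theorem card_sub_stabilizer (hW : g.toSubmodule ^ p = ⊥) {l : Module.Dual K g}
    {q : LieSubalgebra K g} (hq : IsPolarization l q) :
    Nat.card (@MulAction.stabilizer (subExpGroup p q) _ _ (subCoadjointAction hW q) l) =
      Nat.card (radical l) := by
  let := subCoadjointAction hW q
  have h1 : ∀ x : q, (x : g) ∈ radical l ↔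
      subExpEquiv hW q x ∈ MulAction.stabilizer (subExpGroup p q) l := fun x => by
    rw [MulAction.mem_stabilizer_iff, ← neg_mem_iff, ← comp_adjoint_expEquiv_eq_self_iff hW,
      expEquiv_neg]
    rfl
  rw [← Nat.card_congr (Equiv.subtypeEquiv (subExpEquiv hW q) h1)]
  refine Nat.card_congr ⟨fun x => ⟨x.1, x.2⟩, fun x => ⟨⟨x, hq.radical_le x.2⟩, x.2⟩,
    fun _ => rfl, fun _ => rfl⟩

theorem card_radical_mul_card_dualAnnihilator {l : Module.Dual K g}
    {q : LieSubalgebra K g} (hq : IsPolarization l q) :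
    Nat.card (radical l) * Nat.card q.toSubmodule.dualAnnihilator = Nat.card q := by
  refine Nat.eq_of_mul_eq_mul_right (Nat.card_pos (α := q)) ?_
  rw [mul_assoc, card_dualAnnihilator_mul_card, hq.card_mul_card, mul_comm]

/-- Orbit–stabilizer gives `|Ω| = |g| / |rad l|`, while `|rad l| |q^⊥| = |q|` and `|q| |q^⊥| = |g|`.
-/
theorem ncard_coadjointOrbit (hW : g.toSubmodule ^ p = ⊥) {l : Module.Dual K g}
    {q : LieSubalgebra K g} (hq : IsPolarization l q) :
    (coadjointOrbit p g l).ncard =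
      Nat.card q.toSubmodule.dualAnnihilator * Nat.card q.toSubmodule.dualAnnihilator := by
  let := coadjointAction hW
  rw [coadjointOrbit_eq_orbit hW, ← MulAction.index_stabilizer (expGroup p g) l]
  refine Nat.eq_of_mul_eq_mul_left (Nat.card_pos (α := radical l)) ?_
  rw [← card_stabilizer hW l, Subgroup.card_mul_index, card_expGroup hW, card_stabilizer hW l,
    ← mul_assoc, card_radical_mul_card_dualAnnihilator hq, mul_comm,
    card_dualAnnihilator_mul_card]

/-- The forms which agree with `l` on `q` form an orbit of `exp q`. -/
theorem sub_orbit_eq (hW : g.toSubmodule ^ p = ⊥) {l : Module.Dual K g}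
    {q : LieSubalgebra K g} (hq : IsPolarization l q) :
    @MulAction.orbit (subExpGroup p q) _ (subCoadjointAction hW q).toSMul l =
      {m | ∀ y ∈ q, m y = l y} := by
  let := subCoadjointAction hW q
  have := finite_dual (g := g)
  refine Set.eq_of_subset_of_ncard_le ?_ ?_ (Set.toFinite _)
  · rintro _ ⟨u, rfl⟩ y hy
    obtain ⟨x, hx⟩ := (subExpEquiv hW q).surjective u⁻¹
    have h1 := comp_adjoint_expEquiv_apply_of_mem hW hq.prop x.2 hy
    rw [← subExpGroupIncl_subExpEquiv hW q x, hx, map_inv] at h1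
    exact h1
  -- Isotropy gave the inclusion; equality is by counting, as both sets have `|q| / |rad l| = |q^⊥|`
  -- elements.
  · have h1 : {m : Module.Dual K g | ∀ y ∈ q, m y = l y}.ncard =
        Nat.card q.toSubmodule.dualAnnihilator := by
      rw [← Nat.card_coe_set_eq]
      refine Nat.card_congr (Equiv.subtypeEquiv (Equiv.subRight l) fun m => ?_)
      simp [Submodule.mem_dualAnnihilator, sub_eq_zero]
    rw [h1, ← MulAction.index_stabilizer (subExpGroup p q) l]
    refine (Nat.eq_of_mul_eq_mul_left (Nat.card_pos (α := radical l)) ?_).le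
    rw [card_radical_mul_card_dualAnnihilator hq, ← card_sub_stabilizer hW hq,
      Subgroup.card_mul_index, card_subExpGroup hW]

-- The induced character averages `ψ (l (Ad_x a))` over the `x` with `Ad_x a ∈ q`. That cut-off
-- function is itself an average of `ψ (m (Ad_x a))` over the `exp q`-orbit of `l`, and the extra
-- average is absorbed by the sum over `exp g`.
open Representation in
theorem card_mul_char_ind_polarization (hW : g.toSubmodule ^ p = ⊥) {ψ : AddChar K ℂ}
    (hψ : ψ ≠ 1) {l : Module.Dual K g} {q : LieSubalgebra K g} (hq : IsPolarization l q)
    (ξ : Representation ℂ (subExpGroup p q) ℂ)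
    (hξ : ∀ (u : subExpGroup p q) (x : g), x ∈ q →
        ((u : GL (Fin N) K) : Matrix (Fin N) (Fin N) K) = matExp p (x : Matrix (Fin N) (Fin N) K) →
          ∀ z : ℂ, ξ u z = ψ (l x) * z)
    (s : Finset (Module.Dual K g)) (hs : ∀ m, m ∈ s ↔ m ∈ coadjointOrbit p g l) (a : g) :
    (Nat.card q.toSubmodule.dualAnnihilator : ℂ) *
      (ind (subExpGroupIncl p q) ξ).character (expEquiv hW a) = ∑ m ∈ s, ψ (m a) := by
  classical
  have := finite_dual (g := g)
  have : Fintype (expGroup p g) := Fintype.ofFinite _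
  have : Fintype (subExpGroup p q) := Fintype.ofFinite _
  have : Fintype q := Fintype.ofFinite _
  let actG := coadjointAction hW
  let actP := subCoadjointAction hW q
  have hr : (Nat.card (radical l) : ℂ) ≠ 0 := Nat.cast_ne_zero.2 Nat.card_pos.ne'
  have hP : (Fintype.card (subExpGroup p q) : ℂ) ≠ 0 := Nat.cast_ne_zero.2 Fintype.card_ne_zero
  have hξc : ∀ z : q, ξ.character (subExpEquiv hW q z) = ψ (l z) := fun z => by
    have h1 : ξ (subExpEquiv hW q z) = ψ (l z) • LinearMap.id := by
      refine LinearMap.ext fun w => ?_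
      rw [hξ _ (z : g) z.2 rfl w]
      rfl
    rw [character, h1, map_smul, LinearMap.trace_id]
    simp
  have h1 : ∀ y : g, (∑ v : subExpGroup p q,
      if subExpGroupIncl p q v = expEquiv hW y then ξ.character v else 0) =
        if y ∈ q then ψ (l y) else 0 := by
    intro y
    rw [← Fintype.sum_equiv (subExpEquiv hW q)
      (fun z : q => if (z : g) = y then ψ (l z) else 0) _ fun z => by
        rw [subExpGroupIncl_subExpEquiv, hξc]
        simp only [EmbeddingLike.apply_eq_iff_eq]]
    split_ifs with hy
    · rw [Finset.sum_eq_single ⟨y, hy⟩]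
      · simp
      · intro z _ hz
        rw [if_neg fun h => hz (Subtype.ext h)]
      · intro h
        exact absurd (Finset.mem_univ _) h
    · refine Finset.sum_eq_zero fun z _ => if_neg fun h : (z : g) = y => hy (h ▸ z.2)
  have h2 : ∀ y : g, (Nat.card (radical l) : ℂ) *
      ((Nat.card q.toSubmodule.dualAnnihilator : ℂ) * if y ∈ q then ψ (l y) else 0) =
        ∑ v : subExpGroup p q, ψ ((v • l) y) := by
    intro y
    have hS : ∀ m, m ∈ (Set.toFinite {m : Module.Dual K g | ∀ z ∈ q, m z = l z}).toFinset ↔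
        ∀ z ∈ q, m z = l z := fun m => by rw [Set.Finite.mem_toFinset]; rfl
    rw [sum_smul_eq_card_stabilizer_mul l _ (fun m => by rw [sub_orbit_eq hW hq, hS]; rfl)
        (fun m : Module.Dual K g => ψ (m y)),
      card_sub_stabilizer hW hq, sum_addChar_agree hψ l q y _ hS]
    simp
  -- The substitution `x ↦ x⁻¹ v` shows that the sum does not depend on `v`.
  have h3 : ∀ v : subExpGroup p q, ∑ x : expGroup p g, ψ ((v • l) (adjoint hW x a)) =
      ∑ x : expGroup p g, ψ ((x • l) a) := by
    intro v
    refine Fintype.sum_equiv ((Equiv.inv _).trans (Equiv.mulRight (subExpGroupIncl p q v))) _ _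
      fun x => ?_
    have : ((x⁻¹ * subExpGroupIncl p q v) • l) a = (v • l) (adjoint hW x a) := by
      rw [mul_smul]
      change (subExpGroupIncl p q v • l) (adjoint hW x⁻¹⁻¹ a) = _
      rw [inv_inv]
      rfl
    rw [← this]
    rfl
  have h4 : (Nat.card (radical l) : ℂ) * ((Nat.card q.toSubmodule.dualAnnihilator : ℂ) *
      ((Fintype.card (subExpGroup p q) : ℂ) *
        (ind (subExpGroupIncl p q) ξ).character (expEquiv hW a))) =
      (Fintype.card (subExpGroup p q) : ℂ) * ((Nat.card (radical l) : ℂ) * ∑ m ∈ s, ψ (m a)) := by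
    rw [card_mul_char_ind, Finset.sum_comm]
    have h5 : ∀ x : expGroup p g, (∑ v : subExpGroup p q,
        if subExpGroupIncl p q v * x = x * expEquiv hW a then ξ.character v else 0) =
        if adjoint hW x a ∈ q then ψ (l (adjoint hW x a)) else 0 := by
      intro x
      rw [← h1]
      simp only [← conj_expEquiv, eq_mul_inv_iff_mul_eq]
    simp only [h5]
    rw [Finset.mul_sum, Finset.mul_sum]
    simp only [h2]
    rw [Finset.sum_comm]
    simp only [h3]
    rw [Finset.sum_const, nsmul_eq_mul, Finset.card_univ,
      sum_smul_eq_card_stabilizer_mul l s (fun m => by rw [hs, coadjointOrbit_eq_orbit hW])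
        (fun m : Module.Dual K g => ψ (m a)), card_stabilizer hW]
  field_simp at h4
  linear_combination h4

end OrbitCharacter

/-! ### Orthogonality, irreducibility and multiplicities -/

theorem sum_addChar_apply {K L : Type*} [Field K] [AddCommGroup L] [Module K L] [Fintype L]
    {ψ : AddChar K ℂ} (hψ : ψ ≠ 1) (l : Module.Dual K L) [Decidable (l = 0)] :
    ∑ x : L, ψ (l x) = if l = 0 then (Nat.card L : ℂ) else 0 := by
  split_ifs with h
  · simp [h]
  · obtain ⟨y, hy⟩ : ∃ y, l y ≠ 0 := by
      by_contra! h'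
      exact h (LinearMap.ext h')
    obtain ⟨c, hc⟩ := exists_apply_ne_one hψ hy
    have h1 : ∑ x : L, ψ (l x) = ψ (c * l y) * ∑ x : L, ψ (l x) := by
      rw [Finset.mul_sum]
      refine Fintype.sum_equiv (Equiv.subRight (c • y)) _ _ fun x => ?_
      rw [← AddChar.map_add_eq_mul]
      simp
    have h2 : (1 - ψ (c * l y)) * ∑ x : L, ψ (l x) = 0 := by rw [sub_mul, one_mul, ← h1, sub_self]
    exact (mul_eq_zero.1 h2).resolve_left (sub_ne_zero.2 hc.symm)

theorem eq_bot_of_le_bracketSpan_top {K : Type*} [Field K] {N p : ℕ}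
    {g : LieSubalgebra K (Matrix (Fin N) (Fin N) K)} (hW : g.toSubmodule ^ p = ⊥) (J : Submodule K g)
    (hJ : J ≤ bracketSpan ⊤ J) : J = ⊥ := by
  have h1 : J.map g.toSubmodule.subtype = ⊥ := by
    refine eq_bot_of_le_bracketSpan hW (Submodule.map_subtype_le _ _) ?_
    refine (Submodule.map_mono hJ).trans ?_
    rw [bracketSpan, Submodule.map_span, Submodule.span_le]
    rintro _ ⟨_, ⟨x, -, y, hy, rfl⟩, rfl⟩
    exact Submodule.subset_span ⟨x, x.2, y, ⟨y, hy, rfl⟩, rfl⟩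
  exact (Submodule.map_injective_of_injective g.toSubmodule.injective_subtype)
    (h1.trans (Submodule.map_bot _).symm)

section OrbitMethod

open Representation

variable {K : Type*} [Field K] {N : ℕ} [Finite K] {p : ℕ} [CharP K p] [Fact p.Prime]
  {g : LieSubalgebra K (Matrix (Fin N) (Fin N) K)}

theorem mem_coadjointOrbit_self (hW : g.toSubmodule ^ p = ⊥) (l : Module.Dual K g) :
    l ∈ coadjointOrbit p g l := by
  let := coadjointAction hW
  rw [coadjointOrbit_eq_orbit hW]
  exact MulAction.mem_orbit_self l

theorem coadjointOrbit_eq_of_mem (hW : g.toSubmodule ^ p = ⊥) {l m : Module.Dual K g}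
    (h : m ∈ coadjointOrbit p g l) : coadjointOrbit p g m = coadjointOrbit p g l := by
  let := coadjointAction hW
  rw [coadjointOrbit_eq_orbit hW] at h
  rw [coadjointOrbit_eq_orbit hW, coadjointOrbit_eq_orbit hW]
  exact MulAction.orbit_eq_iff.2 h

/-- The character formula for the representations attached to a coadjoint orbit. -/
theorem IsOrbitRep.character_formula (hW : g.toSubmodule ^ p = ⊥) {ψ : AddChar K ℂ}
    (hψ : ψ ≠ 1) {Ω : Set (Module.Dual K g)} (hΩ : IsCoadjointOrbit p g Ω) {V : Type*}
    [AddCommGroup V] [Module ℂ V] {T : Representation ℂ (expGroup p g) V}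
    (hT : IsOrbitRep p ψ Ω T) :
    FiniteDimensional ℂ V ∧ ∃ d : ℕ, d ≠ 0 ∧ Ω.ncard = d * d ∧
      ∀ s : Finset (Module.Dual K g), (∀ m, m ∈ s ↔ m ∈ Ω) →
        ∀ x : g, (d : ℂ) * T.character (expEquiv hW x) = ∑ m ∈ s, ψ (m x) := by
  obtain ⟨l, hl, q, hq, ξ, hξ, ⟨e⟩⟩ := hT
  have hΩl : Ω = coadjointOrbit p g l := by
    obtain ⟨m, rfl⟩ := hΩ
    exact (coadjointOrbit_eq_of_mem hW hl).symm
  have := finite_dual (g := g)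
  have : Module.Finite ℂ (MonoidAlgebra ℂ (expGroup p g)) :=
    Module.Finite.equiv (MonoidAlgebra.coeffLinearEquiv ℂ).symm
  refine ⟨Module.Finite.equiv e.toLinearEquiv.symm,
    Nat.card q.toSubmodule.dualAnnihilator, Nat.card_pos.ne', ?_, fun s hs x => ?_⟩
  · rw [hΩl, ncard_coadjointOrbit hW hq]
  · rw [char_iso e]
    exact card_mul_char_ind_polarization hW hψ hq ξ hξ s (by rw [← hΩl]; exact hs) x

/-- Through `exp`, which carries `-x` to the inverse, the inner product of characters becomes a sum
over the vector space `g` of `ψ ((m i - n j) x)`. It is `|g|` when `m i = n j` and zero otherwise.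
-/
theorem finrank_intertwiningMap_eq_card (hW : g.toSubmodule ^ p = ⊥) {ψ : AddChar K ℂ}
    (hψ : ψ ≠ 1) {V W : Type*} [AddCommGroup V] [Module ℂ V] [FiniteDimensional ℂ V]
    [AddCommGroup W] [Module ℂ W] [FiniteDimensional ℂ W]
    (R : Representation ℂ (expGroup p g) V) (S : Representation ℂ (expGroup p g) W)
    {ι κ : Type*} (s : Finset ι) (t : Finset κ) (m : ι → Module.Dual K g)
    (n : κ → Module.Dual K g) [DecidableEq (Module.Dual K g)] (c d : ℂ)
    (hR : ∀ x, c * R.character (expEquiv hW x) = ∑ i ∈ s, ψ (m i x))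
    (hS : ∀ x, d * S.character (expEquiv hW x) = ∑ j ∈ t, ψ (n j x)) :
    c * d * (Module.finrank ℂ (IntertwiningMap S R) : ℂ) =
      ((s ×ˢ t).filter fun k => m k.1 = n k.2).card := by
  classical
  have : Fintype (expGroup p g) := Fintype.ofFinite _
  have : Fintype g := Fintype.ofFinite _
  have hG : (Nat.card (expGroup p g) : ℂ) ≠ 0 := Nat.cast_ne_zero.2 Nat.card_pos.ne'
  have := invertibleOfNonzero hG
  have hg : (Nat.card g : ℂ) ≠ 0 := Nat.cast_ne_zero.2 Nat.card_pos.ne'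
  rw [← card_inv_mul_sum_char_mul_char_eq_finrank]
  have h1 : c * d * ∑ u : expGroup p g, R.character u * S.character u⁻¹ =
      (Nat.card g : ℂ) * ((s ×ˢ t).filter fun k => m k.1 = n k.2).card := by
    rw [← Fintype.sum_equiv (expEquiv hW)
      (fun x => R.character (expEquiv hW x) * S.character (expEquiv hW (-x))) _
      fun x => by rw [expEquiv_neg], Finset.mul_sum]
    have h2 : ∀ x : g, c * d * (R.character (expEquiv hW x) * S.character (expEquiv hW (-x))) =
        ∑ k ∈ s ×ˢ t, ψ ((m k.1 - n k.2) x) := by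
      intro x
      rw [mul_mul_mul_comm, hR, hS, Finset.sum_mul_sum, ← Finset.sum_product']
      refine Finset.sum_congr rfl fun k _ => ?_
      rw [← AddChar.map_add_eq_mul, LinearMap.sub_apply, map_neg, sub_eq_add_neg]
    simp only [h2]
    rw [Finset.sum_comm]
    simp only [sum_addChar_apply hψ, sub_eq_zero]
    rw [← Finset.sum_filter, Finset.sum_const, nsmul_eq_mul, mul_comm]
  rw [mul_left_comm, h1, card_expGroup hW, inv_mul_cancel_left₀ hg]

theorem IsOrbitRep.isIrreducible (hW : g.toSubmodule ^ p = ⊥) {ψ : AddChar K ℂ}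
    (hψ : ψ ≠ 1) {Ω : Set (Module.Dual K g)} (hΩ : IsCoadjointOrbit p g Ω) {V : Type*}
    [AddCommGroup V] [Module ℂ V] {T : Representation ℂ (expGroup p g) V}
    (hT : IsOrbitRep p ψ Ω T) : T.IsIrreducible := by
  classical
  obtain ⟨_, d, hd, hcard, hchar⟩ := hT.character_formula hW hψ hΩ
  have := finite_dual (g := g)
  let s := (Set.toFinite Ω).toFinset
  have hs : ∀ m, m ∈ s ↔ m ∈ Ω := fun m => Set.Finite.mem_toFinset _
  refine isIrreducible_of_finrank_eq_one T ?_
  have h1 := finrank_intertwiningMap_eq_card hW hψ T T s s id id d d (hchar s hs) (hchar s hs)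
  -- The coincidences lie on the diagonal of `Ω × Ω`, and `|Ω| = d²`, so the intertwining number is
  -- `1`.
  have h2 : ((s ×ˢ s).filter fun k => id k.1 = id k.2).card = d * d := by
    rw [← hcard, Set.ncard_eq_toFinset_card Ω]
    refine Finset.card_bij' (fun k _ => k.1) (fun m _ => (m, m)) ?_ ?_ ?_ ?_
    · intro k hk
      exact (Finset.mem_product.1 (Finset.mem_filter.1 hk).1).1
    · intro m hm
      exact Finset.mem_filter.2 ⟨Finset.mem_product.2 ⟨hm, hm⟩, rfl⟩
    · intro k hk
      exact Prod.ext rfl (Finset.mem_filter.1 hk).2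
    · intro m _
      rfl
  rw [h2] at h1
  have hd' : (d : ℂ) ≠ 0 := Nat.cast_ne_zero.2 hd
  push_cast at h1
  exact_mod_cast mul_left_cancel₀ (mul_ne_zero hd' hd') (h1.trans (mul_one _).symm)

/-- The character `exp x ↦ ψ (l x)` of `exp q`, for `l` vanishing on `⁅q, q⁆`. -/
theorem exists_linear_character (hW : g.toSubmodule ^ p = ⊥) (ψ : AddChar K ℂ)
    {l : Module.Dual K g} {q : LieSubalgebra K g} (hq : IsIsotropic l q.toSubmodule) :
    ∃ ξ : Representation ℂ (subExpGroup p q) ℂ,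
      ∀ (u : subExpGroup p q) (x : g), x ∈ q →
        ((u : GL (Fin N) K) : Matrix (Fin N) (Fin N) K) = matExp p (x : Matrix (Fin N) (Fin N) K) →
          ∀ z : ℂ, ξ u z = ψ (l x) * z := by
  -- The additivity of forms on products of exponentials is stated for forms on the whole matrix
  -- algebra.
  obtain ⟨f, hf⟩ := LinearMap.exists_extend (p := g.toSubmodule) l
  have hfl : ∀ x : g, f x = l x := fun x => LinearMap.congr_fun hf x
  have hadd : ∀ a b : subExpGroup p q, l ((subExpEquiv hW q).symm (a * b) : g) =
      l ((subExpEquiv hW q).symm a : g) + l ((subExpEquiv hW q).symm b : g) := by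
    intro a b
    obtain ⟨x, rfl⟩ := (subExpEquiv hW q).surjective a
    obtain ⟨y, rfl⟩ := (subExpEquiv hW q).surjective b
    obtain ⟨z, hz⟩ := (subExpEquiv hW q).surjective (subExpEquiv hW q x * subExpEquiv hW q y)
    rw [← hz, Equiv.symm_apply_apply, Equiv.symm_apply_apply, Equiv.symm_apply_apply, ← hfl,
      ← hfl, ← hfl]
    refine apply_eq_add_of_truncExp_mul_eq p (map_incl_pow_eq_bot hW q)
      (fun a ha b hb => (q.map g.incl).lie_mem ha hb) f ?_ ⟨x, x.2, rfl⟩ ⟨y, y.2, rfl⟩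
      ⟨z, z.2, rfl⟩
      (congrArg (fun u : subExpGroup p q => ((u : GL (Fin N) K) : Matrix (Fin N) (Fin N) K)) hz).symm
    rintro _ ⟨a, ha, rfl⟩ _ ⟨b, hb, rfl⟩
    exact (hfl ⁅a, b⁆).trans (hq a ha b hb)
  let ξ : Representation ℂ (subExpGroup p q) ℂ :=
    { toFun := fun u => ψ (l ((subExpEquiv hW q).symm u : g)) • LinearMap.id
      map_one' := by
        have := hadd 1 1
        rw [mul_one, left_eq_add] at this
        rw [this, AddChar.map_zero_eq_one, one_smul]
        rfl
      map_mul' := fun a b => by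
        rw [hadd, AddChar.map_add_eq_mul]
        refine LinearMap.ext fun z => ?_
        exact mul_assoc (ψ _) (ψ _) z }
  refine ⟨ξ, fun u x hx hu z => ?_⟩
  have h1 : u = subExpEquiv hW q ⟨x, hx⟩ := Subtype.ext (Units.ext hu)
  change ψ (l ((subExpEquiv hW q).symm u : g)) * z = _
  rw [h1, Equiv.symm_apply_apply]

theorem exists_isOrbitRep {K : Type u} [Field K] [Finite K] {p : ℕ} [CharP K p] [Fact p.Prime]
    {g : LieSubalgebra K (Matrix (Fin N) (Fin N) K)} (hW : g.toSubmodule ^ p = ⊥)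
    (ψ : AddChar K ℂ) {Ω : Set (Module.Dual K g)} (hΩ : IsCoadjointOrbit p g Ω) :
    ∃ (V : Type u) (_ : AddCommGroup V) (_ : Module ℂ V)
      (T : Representation ℂ (expGroup p g) V), IsOrbitRep p ψ Ω T := by
  obtain ⟨l, rfl⟩ := hΩ
  obtain ⟨q, hq⟩ := exists_isPolarization (eq_bot_of_le_bracketSpan_top hW) l
  obtain ⟨ξ, hξ⟩ := exists_linear_character hW ψ hq.prop
  exact ⟨_, _, _, ind (subExpGroupIncl p q) ξ, l, mem_coadjointOrbit_self hW l, q, hq, ξ, hξ,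
    ⟨Representation.Equiv.refl _⟩⟩

/-- The multiplicity of an orbit representation of `exp h` in the restriction of an orbit
representation of `exp g`. -/
theorem IsOrbitRep.finrank_intertwiningMap_comp (hW : g.toSubmodule ^ p = ⊥)
    {ψ : AddChar K ℂ} (hψ : ψ ≠ 1) {h : LieSubalgebra K (Matrix (Fin N) (Fin N) K)}
    (hle : h ≤ g) {Ω : Set (Module.Dual K g)} (hΩ : IsCoadjointOrbit p g Ω)
    {ω : Set (Module.Dual K h)} (hω : IsCoadjointOrbit p h ω)
    {V : Type*} [AddCommGroup V] [Module ℂ V] {T : Representation ℂ (expGroup p g) V}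
    {W : Type*} [AddCommGroup W] [Module ℂ W] {t : Representation ℂ (expGroup p h) W}
    (hT : IsOrbitRep p ψ Ω T) (ht : IsOrbitRep p ψ ω t) :
    (Module.finrank ℂ (IntertwiningMap t (T.comp (expIncl p hle))) : ℝ) =
      ((restrict hle ⁻¹' ω ∩ Ω).ncard : ℝ) / Real.sqrt ((ω.ncard : ℝ) * (Ω.ncard : ℝ)) := by
  classical
  have hWh : h.toSubmodule ^ p = ⊥ := pow_eq_bot_mono hle hW
  obtain ⟨_, d, hd, hcard, hchar⟩ := hT.character_formula hW hψ hΩ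
  obtain ⟨_, e, he, hcard', hchar'⟩ := ht.character_formula hWh hψ hω
  have := finite_dual (g := g)
  have := finite_dual (g := h)
  have hs : ∀ m, m ∈ (Set.toFinite Ω).toFinset ↔ m ∈ Ω := fun m => Set.Finite.mem_toFinset _
  have hs' : ∀ m, m ∈ (Set.toFinite ω).toFinset ↔ m ∈ ω := fun m => Set.Finite.mem_toFinset _
  -- On `exp h` the character formula of `T` involves only the restrictions to `h` of the forms in
  -- `Ω`, counted with repetition; hence the indexed families.
  have h1 := finrank_intertwiningMap_eq_card hWh hψ (T.comp (expIncl p hle)) t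
    (Set.toFinite Ω).toFinset (Set.toFinite ω).toFinset (restrict hle) id d e
    (fun x => hchar _ hs (LieSubalgebra.inclusion hle x)) (hchar' _ hs')
  have h2 : (((Set.toFinite Ω).toFinset ×ˢ (Set.toFinite ω).toFinset).filter
      fun k => restrict hle k.1 = id k.2).card = (restrict hle ⁻¹' ω ∩ Ω).ncard := by
    rw [Set.ncard_eq_toFinset_card _]
    refine Finset.card_bij' (fun k _ => k.1) (fun m _ => (m, restrict hle m)) ?_ ?_ ?_ ?_
    · intro k hk
      obtain ⟨hk, he⟩ := Finset.mem_filter.1 hk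
      obtain ⟨h1, h2⟩ := Finset.mem_product.1 hk
      rw [Set.Finite.mem_toFinset]
      refine ⟨?_, (hs _).1 h1⟩
      rw [Set.mem_preimage, he]
      exact (hs' _).1 h2
    · intro m hm
      rw [Set.Finite.mem_toFinset] at hm
      exact Finset.mem_filter.2 ⟨Finset.mem_product.2 ⟨(hs _).2 hm.2, (hs' _).2 hm.1⟩, rfl⟩
    · intro k hk
      exact Prod.ext rfl (Finset.mem_filter.1 hk).2
    · intro m _
      rfl
  rw [h2] at h1
  -- Both orbits have square cardinality, so the root is the product of the two normalizing
  -- constants.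
  have h3 : Real.sqrt ((ω.ncard : ℝ) * (Ω.ncard : ℝ)) = d * e := by
    rw [hcard, hcard', Real.sqrt_eq_iff_mul_self_eq (by positivity) (by positivity)]
    push_cast
    ring
  have hd' : (d : ℝ) ≠ 0 := Nat.cast_ne_zero.2 hd
  have he' : (e : ℝ) ≠ 0 := Nat.cast_ne_zero.2 he
  rw [h3, eq_div_iff (mul_ne_zero hd' he'), mul_comm]
  exact_mod_cast h1

end OrbitMethod

end UnipotentOrbit
end
-- The multiplicity theorem
theorem mainTheorem1 {K : Type u} [Field K] [Finite K] (p : ℕ) [CharP K p] (N : ℕ)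
    (g : LieSubalgebra K (Matrix (Fin N) (Fin N) K)) (hg : g ≤ UnipotentOrbit.ut N K)
    (hp : ∀ s : List (Matrix (Fin N) (Fin N) K), (∀ x ∈ s, x ∈ g) → s.length = p → s.prod = 0)
    (ψ : AddChar K ℂ) (hψ : ψ ≠ 1)
    (h : LieSubalgebra K (Matrix (Fin N) (Fin N) K)) (hle : h ≤ g)
    (Ω : Set (Module.Dual K g)) (hΩ : UnipotentOrbit.IsCoadjointOrbit p g Ω)
    (ω : Set (Module.Dual K h)) (hω : UnipotentOrbit.IsCoadjointOrbit p h ω) :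
    -- `G` and `H` are the sets `exp 𝔤` and `exp 𝔥`, parametrized bijectively
    Set.BijOn (UnipotentOrbit.matExp p) (g : Set (Matrix (Fin N) (Fin N) K))
      ((fun u : GL (Fin N) K => (u : Matrix (Fin N) (Fin N) K)) ''
        (UnipotentOrbit.expGroup p g : Set (GL (Fin N) K))) ∧
    Set.BijOn (UnipotentOrbit.matExp p) (h : Set (Matrix (Fin N) (Fin N) K))
      ((fun u : GL (Fin N) K => (u : Matrix (Fin N) (Fin N) K)) ''
        (UnipotentOrbit.expGroup p h : Set (GL (Fin N) K))) ∧
    -- the classes `T^Ω` and `t^ω` are not empty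
    (∃ (V : Type u) (_ : AddCommGroup V) (_ : Module ℂ V)
      (T : Representation ℂ (UnipotentOrbit.expGroup p g) V),
      UnipotentOrbit.IsOrbitRep p ψ Ω T) ∧
    (∃ (W : Type u) (_ : AddCommGroup W) (_ : Module ℂ W)
      (t : Representation ℂ (UnipotentOrbit.expGroup p h) W),
      UnipotentOrbit.IsOrbitRep p ψ ω t) ∧
    -- they consist of irreducible representations, with the stated multiplicities
    ∀ (V : Type v) [AddCommGroup V] [Module ℂ V]
      (T : Representation ℂ (UnipotentOrbit.expGroup p g) V)
      (W : Type w) [AddCommGroup W] [Module ℂ W]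
      (t : Representation ℂ (UnipotentOrbit.expGroup p h) W),
      UnipotentOrbit.IsOrbitRep p ψ Ω T → UnipotentOrbit.IsOrbitRep p ψ ω t →
      T.IsIrreducible ∧ t.IsIrreducible ∧
      UnipotentOrbit.mult T (Representation.ind (UnipotentOrbit.expIncl p hle) t) =
        UnipotentOrbit.mult t (T.comp (UnipotentOrbit.expIncl p hle)) ∧
      (UnipotentOrbit.mult T (Representation.ind (UnipotentOrbit.expIncl p hle) t) : ℝ) =
        ((UnipotentOrbit.restrict hle ⁻¹' ω ∩ Ω).ncard : ℝ) /
          Real.sqrt ((ω.ncard : ℝ) * (Ω.ncard : ℝ)) := by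
  classical
  have hprime : Fact p.Prime := ⟨(CharP.char_is_prime_or_zero K p).resolve_right fun h0 =>
    CharP.char_ne_zero_of_finite K p h0⟩
  have hW : g.toSubmodule ^ p = ⊥ := UnipotentOrbit.pow_eq_bot_of_prod_eq_zero hp
  have hWh : h.toSubmodule ^ p = ⊥ := UnipotentOrbit.pow_eq_bot_mono hle hW
  refine ⟨UnipotentOrbit.bijOn_matExp hW, UnipotentOrbit.bijOn_matExp hWh,
    UnipotentOrbit.exists_isOrbitRep hW ψ hΩ, UnipotentOrbit.exists_isOrbitRep hWh ψ hω, ?_⟩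
  intro V _ _ T W _ _ t hT ht
  have hTirr := hT.isIrreducible hW hψ hΩ
  have htirr := ht.isIrreducible hWh hψ hω
  have hV := (hT.character_formula hW hψ hΩ).1
  have hW' := (ht.character_formula hWh hψ hω).1
  have : Module.Finite ℂ (MonoidAlgebra ℂ (UnipotentOrbit.expGroup p g)) :=
    Module.Finite.equiv (MonoidAlgebra.coeffLinearEquiv ℂ).symm
  have h1 := UnipotentOrbit.finrank_intertwiningMap_ind (UnipotentOrbit.expIncl p hle) t T
  rw [UnipotentOrbit.mult_eq_finrank _ hTirr, UnipotentOrbit.mult_eq_finrank _ htirr]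
  refine ⟨hTirr, htirr, h1, ?_⟩
  rw [h1]
  exact hT.finrank_intertwiningMap_comp hW hψ hle hΩ hω ht
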